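/- Let $\mathbb K$ be $\mathbb R$ or $\mathbb C$; Banach spaces are over $\mathbb K$, $E^*$ is the topological dual of $E$, and $\mathcal L(E,F)$ is the space of bounded linear operators from $E$ to $F$. A pointed metric space is a metric space $X$ with a base point $0$; $\mathrm{Lip}_0(X,Y)$ is the set of base-point preserving Lipschitz maps between pointed metric spaces (Banach spaces have base point the zero vector), $\mathrm{Lip}(f)$ is the least Lipschitz constant of $f$, and $X^\#=\mathrm{Lip}_0(X,\mathbb K)$. The Lipschitz tensor product $X\boxtimes E$ is the linear span of the functionals $\delta_{(x,y)}\boxtimes e\colon f\mapsto\langle f(x)-f(y),e\rangle$ $(x,y\in X,\ e\in E)$ on $\mathrm{Lip}_0(X,E^*)$. For $h\in \mathrm{Lip}_0(X,Y)$ and $T\in\mathcal L(E,F)$, $h\boxtimes T\colon X\boxtimes E\to Y\boxtimes F$ is the linear map with $\delta_{(x,y)}\boxtimes e\mapsto \delta_{(h(x),h(y))}\boxtimes Te$. A generic Lipschitz cross-norm $\alpha$ assigns to each pointed metric space $X$ and each Banach space $E$ a norm $\alpha(\cdot;X,E)$ on $X\boxtimes E$ such that * $\alpha(\delta_{(x,y)}\boxtimes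 e;X,E)=d(x,y)\|e\|$ for all $x,y\in X$, $e\in E$; * $\bigl|\sum_i (g(x_i)-g(y_i))\langle\phi,e_i\rangle\bigr|\le \mathrm{Lip}(g)\,\|\phi\|\,\alpha\bigl(\sum_i\delta_{(x_i,y_i)}\boxtimes e_i;X,E\bigr)$ for all $g\in X^\#$, $\phi\in E^*$ and $\sum_i\delta_{(x_i,y_i)}\boxtimes e_i\in X\boxtimes E$; * $\alpha((h\boxtimes T)u;X_1,E_1)\le \mathrm{Lip}(h)\,\|T\|\,\alpha(u;X_0,E_0)$ for all $h\in\mathrm{Lip}_0(X_0,X_1)$, $T\in\mathcal L(E_0,E_1)$, $u\in X_0\boxtimes E_0$. It is finitely generated if, for all $X$, $E$ and $u\in X\boxtimes E$, $\alpha(u;X,E)$ is the infimum of $\alpha(u;X_0,E_0)$ over all finite $X_0\subset X$ containing $0$ and all finite-dimensional subspaces $E_0\subset E$ with $u\in X_0\boxtimes E_0$ (where $X_0\boxtimes E_0$ is viewed in $X\boxtimes E$ via the inclusions). $X\widehat\boxtimes_\alpha E$ denotes the completion of $(X\boxtimes E,\alpha)$. A generic Lipschitz operator Banach ideal $A$ assigns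 to each pointed metric space $X$ and each Banach space $E$ a linear subspace $A(X,E)\subset \mathrm{Lip}_0(X,E)$ with a norm $\|\cdot\|_A$ such that * for $g\in X^\#$ and $e\in E$, the map $g\cdot e\colon x\mapsto g(x)e$ is in $A(X,E)$ and $\|g\cdot e\|_A\le\mathrm{Lip}(g)\|e\|$; * $\mathrm{Lip}(f)\le\|f\|_A$ for all $f\in A(X,E)$; * $(A(X,E),\|\cdot\|_A)$ is complete; * if $f\in A(X,E)$, $h\in\mathrm{Lip}_0(Z,X)$ and $S\in\mathcal L(E,F)$, then $Sfh\in A(Z,F)$ and $\|Sfh\|_A\le\|S\|\,\|f\|_A\,\mathrm{Lip}(h)$. For $f\in \mathrm{Lip}_0(X,E)$ put $\|f\|_{A^{\max}}=\sup_{Y,L}\|Q_L\circ f\circ I_Y\|_A$, over all finite $Y\subset X$ containing $0$ (with inclusion $I_Y\colon Y\to X$) and all closed finite-codimensional subspaces $L\subset E$ (with quotient map $Q_L\colon E\to E/L$). $A$ is maximal if, for all $X$ and $E$, $A(X,E)=\{f\in\mathrm{Lip}_0(X,E):\|f\|_{A^{\max}}<\infty\}$ and $\|f\|_A=\|f\|_{A^{\max}}$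 for every $f\in A(X,E)$. **Theorem.** Let $A$ be a generic Lipschitz operator Banach ideal. Then $A$ is maximal if and only if there exists a finitely generated generic Lipschitz cross-norm $\alpha$ such that, for every pointed metric space $X$ and every Banach space $E$, $$A(X,E)=(X\widehat\boxtimes_\alpha E^*)^*\cap\mathrm{Lip}_0(X,E)\qquad(1)$$ holds isometrically; that is, $f\in\mathrm{Lip}_0(X,E)$ belongs to $A(X,E)$ if and only if the functional $\sum_i\delta_{(x_i,y_i)}\boxtimes e_i^*\mapsto\sum_i\langle e_i^*,f(x_i)-f(y_i)\rangle$ on $X\boxtimes E^*$ extends to a continuous linear functional on $X\widehat\boxtimes_\alpha E^*$, and in that case $\|f\|_A$ is the norm of the extension. Moreover, whenever $\alpha$ is a finitely generated generic Lipschitz cross-norm for which (1) holds isometrically for all $X$ and $E$, then also $$A(X,E^*)=(X\widehat\boxtimes_\alpha E)^*$$ holds isometrically for every pointed metric space $X$ and every Banach space $E$; that is, sending $f$ to the continuous extension of $\sum_i\delta_{(x_i,y_i)}\boxtimes e_i\mapsto\sum_i\langle f(x_i)-f(y_i),e_i\rangle$ is a surjective linear isometry from $A(X,E^*)$ onto $(X\widehat\boxtimes_\alpha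 E)^*$. -/

import Mathlib

open scoped NNReal ENNReal

universe u v

namespace LipschitzIdeals

/-! ## Norms on vector spaces, as data -/

/-- A norm on the `𝕜`-vector space `V`, as a piece of data (not as an instance). -/
structure VectorNorm (𝕜 : Type) [RCLike 𝕜] (V : Type*) [AddCommGroup V] [Module 𝕜 V]
    extends Seminorm 𝕜 V where
  eq_zero_of_toFun : ∀ x : V, toFun x = 0 → x = 0

namespace VectorNorm

variable {𝕜 : Type} [RCLike 𝕜] {V : Type*} [AddCommGroup V] [Module 𝕜 V]

instance : CoeFun (VectorNorm 𝕜 V) (fun _ => V → ℝ) := ⟨fun p => p.toSeminorm⟩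

/-- The normed space `(V, p)`: a copy of `V` carrying the norm `p`. -/
def Space (_ : VectorNorm 𝕜 V) : Type _ := V

instance (p : VectorNorm 𝕜 V) : AddCommGroup p.Space := inferInstanceAs (AddCommGroup V)

instance (p : VectorNorm 𝕜 V) : Module 𝕜 p.Space := inferInstanceAs (Module 𝕜 V)

instance (p : VectorNorm 𝕜 V) : Norm p.Space := ⟨fun x => p.toSeminorm x⟩

theorem core (p : VectorNorm 𝕜 V) : NormedSpace.Core 𝕜 p.Space where
  norm_nonneg x := apply_nonneg p.toSeminorm x
  norm_smul c x := map_smul_eq_mul p.toSeminorm c x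
  norm_triangle x y := map_add_le_add p.toSeminorm x y
  norm_eq_zero_iff x := ⟨p.eq_zero_of_toFun x, fun h => by
    rw [h]; exact map_zero p.toSeminorm⟩

noncomputable instance (p : VectorNorm 𝕜 V) : NormedAddCommGroup p.Space :=
  NormedAddCommGroup.ofCore p.core

noncomputable instance (p : VectorNorm 𝕜 V) : NormedSpace 𝕜 p.Space :=
  NormedSpace.ofCore p.core

/-- The identity map from `V` to the normed space `(V, p)`. -/
def toSpace (p : VectorNorm 𝕜 V) : V ≃ₗ[𝕜] p.Space := LinearEquiv.refl 𝕜 V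

end VectorNorm

/-! ## Lipschitz maps between pointed metric spaces

A pointed metric space is a type `X` with `[MetricSpace X] [Zero X]`; the base point is `0`. -/

/-- `Lip(f)`: the least Lipschitz constant of `f` (used for Lipschitz maps only). -/
noncomputable def lipConst {X Y : Type*} [MetricSpace X] [MetricSpace Y] (f : X → Y) : ℝ :=
  sInf {C : ℝ | 0 ≤ C ∧ ∀ x y, dist (f x) (f y) ≤ C * dist x y}

/-- `f` is a base-point preserving Lipschitz map. -/
def IsLip0 {X Y : Type*} [MetricSpace X] [Zero X] [MetricSpace Y] [Zero Y] (f : X → Y) : Prop :=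
  f 0 = 0 ∧ ∃ K : ℝ≥0, LipschitzWith K f

/-- `Lip₀(X, Y)` for pointed metric spaces. -/
def PLip (X Y : Type*) [MetricSpace X] [Zero X] [MetricSpace Y] [Zero Y] : Type _ :=
  {h : X → Y // IsLip0 h}

section Lip0

variable (𝕜 : Type) [RCLike 𝕜] (X : Type*) [MetricSpace X] [Zero X]
  (E : Type*) [NormedAddCommGroup E] [NormedSpace 𝕜 E]

/-- The vector space `Lip₀(X, E)` of Lipschitz operators from `X` to the normed space `E`. -/
def Lip0 : Submodule 𝕜 (X → E) where
  carrier := {f | IsLip0 f}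
  zero_mem' := ⟨rfl, 0, LipschitzWith.const 0⟩
  add_mem' := by
    rintro f g ⟨hf, K, hK⟩ ⟨hg, M, hM⟩
    exact ⟨by simp [hf, hg], K + M, hK.add hM⟩
  smul_mem' := by
    rintro c f ⟨hf, K, hK⟩
    exact ⟨by simp [hf], ‖c‖₊ * K, (lipschitzWith_smul c).comp hK⟩

end Lip0

section Maps

variable {𝕜 : Type} [RCLike 𝕜] {X Y : Type*} [MetricSpace X] [Zero X] [MetricSpace Y] [Zero Y]
  {E F : Type*} [NormedAddCommGroup E] [NormedSpace 𝕜 E] [NormedAddCommGroup F] [NormedSpace 𝕜 F]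

/-- The composition `S ∘ f ∘ h` in `Lip₀(X, F)`, for `h ∈ Lip₀(X, Y)`, `f ∈ Lip₀(Y, E)` and
`S ∈ L(E, F)`; it depends linearly on `f`. -/
def comp (S : E →L[𝕜] F) (h : PLip X Y) : Lip0 𝕜 Y E →ₗ[𝕜] Lip0 𝕜 X F where
  toFun f := ⟨fun x => S (f.1 (h.1 x)), by
    obtain ⟨f, hf, K, hK⟩ := f
    obtain ⟨h, hh, M, hM⟩ := h
    exact ⟨by simp [hf, hh], ‖S‖₊ * (K * M), S.lipschitz.comp (hK.comp hM)⟩⟩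
  map_add' f g := by ext x; simp
  map_smul' c f := by ext x; simp

/-- The Lipschitz rank-one operator `g · e : x ↦ g(x) e`. -/
def rankOne (g : Lip0 𝕜 X 𝕜) (e : E) : Lip0 𝕜 X E :=
  ⟨fun x => g.1 x • e, by
    obtain ⟨g, hg, K, hK⟩ := g
    refine ⟨by simp [hg], K * ‖e‖₊, LipschitzWith.of_dist_le_mul fun x y => ?_⟩
    have h1 : dist (g x) (g y) ≤ K * dist x y := hK.dist_le_mul x y
    rw [dist_eq_norm] at h1
    rw [dist_eq_norm, ← sub_smul, norm_smul]
    calc ‖g x - g y‖ * ‖e‖ ≤ (K * dist x y) * ‖e‖ := by gcongr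
      _ = ((K * ‖e‖₊ : ℝ≥0) : ℝ) * dist x y := by push_cast; ring⟩

end Maps

/-- The identity of a pointed metric space. -/
def PLip.id (X : Type*) [MetricSpace X] [Zero X] : PLip X X :=
  ⟨_root_.id, rfl, 1, LipschitzWith.id⟩

/-! ## The Lipschitz tensor product -/

section Tensor

variable {𝕜 : Type} [RCLike 𝕜] {X Y : Type*} [MetricSpace X] [Zero X] [MetricSpace Y] [Zero Y]
  {E F : Type*} [NormedAddCommGroup E] [NormedSpace 𝕜 E] [NormedAddCommGroup F] [NormedSpace 𝕜 F]

/-- The functional `δ_(x,y) ⊠ e : f ↦ ⟨f(x) - f(y), e⟩` on `Lip₀(X, E*)`. -/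
noncomputable def deltaFun (x y : X) (e : E) : Module.Dual 𝕜 (Lip0 𝕜 X (StrongDual 𝕜 E)) where
  toFun f := (f.1 x - f.1 y) e
  map_add' f g := by simp; ring
  map_smul' c f := by simp [mul_sub]

variable (𝕜 X E) in
/-- The Lipschitz tensor product `X ⊠ E`: the linear span of the functionals `δ_(x,y) ⊠ e`. -/
noncomputable def LipTensor : Submodule 𝕜 (Module.Dual 𝕜 (Lip0 𝕜 X (StrongDual 𝕜 E))) :=
  Submodule.span 𝕜 (Set.range fun p : X × X × E => deltaFun (𝕜 := 𝕜) p.1 p.2.1 p.2.2)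

variable (𝕜) in
/-- `δ_(x,y) ⊠ e` as an element of `X ⊠ E`. -/
noncomputable def delta (x y : X) (e : E) : LipTensor 𝕜 X E :=
  ⟨deltaFun x y e, Submodule.subset_span ⟨(x, y, e), rfl⟩⟩

/-- The adjoint `T* : F* → E*` of `T : E → F`. -/
noncomputable def adj (T : E →L[𝕜] F) : StrongDual 𝕜 F →L[𝕜] StrongDual 𝕜 E :=
  (ContinuousLinearMap.compL 𝕜 E F 𝕜).flip T

theorem dualMap_mem (h : PLip X Y) (T : E →L[𝕜] F) :
    ∀ u ∈ LipTensor 𝕜 X E, (comp (adj T) h).dualMap u ∈ LipTensor 𝕜 Y F := by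
  intro u hu
  refine Submodule.span_induction (p := fun u _ => (comp (adj T) h).dualMap u ∈ LipTensor 𝕜 Y F)
    ?_ ?_ ?_ ?_ hu
  · rintro _ ⟨⟨x, y, e⟩, rfl⟩
    refine Submodule.subset_span ⟨(h.1 x, h.1 y, T e), ?_⟩
    ext f
    simp [deltaFun, comp, adj]
  · simp
  · intro a b _ _ ha hb
    rw [map_add]; exact add_mem ha hb
  · intro c a _ ha
    rw [map_smul]; exact Submodule.smul_mem _ c ha

/-- The linear map `h ⊠ T : X ⊠ E → Y ⊠ F`, given by `((h ⊠ T) u)(f) = u(T* ∘ f ∘ h)`. -/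
noncomputable def tmap (h : PLip X Y) (T : E →L[𝕜] F) : LipTensor 𝕜 X E →ₗ[𝕜] LipTensor 𝕜 Y F :=
  (comp (adj T) h).dualMap.restrict (dualMap_mem h T)

/-- `(h ⊠ T)(δ_(x,y) ⊠ e) = δ_(h(x),h(y)) ⊠ T(e)`. -/
theorem tmap_delta (h : PLip X Y) (T : E →L[𝕜] F) (x y : X) (e : E) :
    tmap h T (delta 𝕜 x y e) = delta 𝕜 (h.1 x) (h.1 y) (T e) := by
  apply Subtype.ext
  ext f
  simp [tmap, delta, deltaFun, comp, adj]

end Tensor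

/-! ## Finite pointed subsets, finite-dimensional and finite-codimensional subspaces -/

/-- `MFIN(X)`: the finite subsets of `X` that contain the base point. -/
structure MFin (X : Type u) [Zero X] where
  set : Set X
  finite : set.Finite
  zero_mem : (0 : X) ∈ set

namespace MFin

variable {X : Type u} [MetricSpace X] [Zero X]

/-- A member of `MFIN(X)`, as a type. -/
def Pt (Y : MFin X) : Type u := Y.set

instance (Y : MFin X) : MetricSpace Y.Pt := inferInstanceAs (MetricSpace Y.set)

instance (Y : MFin X) : Zero Y.Pt := ⟨⟨0, Y.zero_mem⟩⟩

/-- The canonical injection `Y → X`. -/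
def incl (Y : MFin X) : PLip Y.Pt X :=
  ⟨fun y => y.1, rfl, 1, LipschitzWith.subtype_val Y.set⟩

end MFin

/-- `FIN(E)`: the finite-dimensional subspaces of `E`. -/
structure FinDim (𝕜 : Type) [RCLike 𝕜] (E : Type v) [NormedAddCommGroup E] [NormedSpace 𝕜 E] where
  sub : Submodule 𝕜 E
  finiteDimensional : FiniteDimensional 𝕜 sub

instance {𝕜 : Type} [RCLike 𝕜] {E : Type v} [NormedAddCommGroup E] [NormedSpace 𝕜 E]
    (M : FinDim 𝕜 E) : CompleteSpace M.sub :=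
  haveI := M.finiteDimensional
  FiniteDimensional.complete 𝕜 M.sub

/-- `COFIN(E)`: the (closed) finite-codimensional subspaces of `E`. -/
structure CoFin (𝕜 : Type) [RCLike 𝕜] (E : Type v) [NormedAddCommGroup E] [NormedSpace 𝕜 E] where
  sub : Submodule 𝕜 E
  isClosed : IsClosed (sub : Set E)
  finiteDimensional : FiniteDimensional 𝕜 (E ⧸ sub)

instance {𝕜 : Type} [RCLike 𝕜] {E : Type v} [NormedAddCommGroup E] [NormedSpace 𝕜 E]
    (L : CoFin 𝕜 E) : IsClosed (L.sub : Set E) := L.isClosed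

/-- The canonical projection `E → E / L`. -/
noncomputable def CoFin.proj {𝕜 : Type} [RCLike 𝕜] {E : Type v} [NormedAddCommGroup E]
    [NormedSpace 𝕜 E] (L : CoFin 𝕜 E) : E →L[𝕜] (E ⧸ L.sub) :=
  L.sub.mkQL

/-! ## Generic Lipschitz cross-norms -/

/-- A generic Lipschitz cross-norm: for each pointed metric space `X` and each Banach space `E`, a
dualizable Lipschitz cross-norm on `X ⊠ E`, subject to the metric mapping property. -/
structure GenericCrossNorm (𝕜 : Type) [RCLike 𝕜] where
  nrm : ∀ (X : Type u) [MetricSpace X] [Zero X] (E : Type v) [NormedAddCommGroup E]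
    [NormedSpace 𝕜 E] [CompleteSpace E], VectorNorm 𝕜 (LipTensor 𝕜 X E)
  cross : ∀ (X : Type u) [MetricSpace X] [Zero X] (E : Type v) [NormedAddCommGroup E]
    [NormedSpace 𝕜 E] [CompleteSpace E] (x y : X) (e : E),
    nrm X E (delta 𝕜 x y e) = dist x y * ‖e‖
  dualizable : ∀ (X : Type u) [MetricSpace X] [Zero X] (E : Type v) [NormedAddCommGroup E]
    [NormedSpace 𝕜 E] [CompleteSpace E] (g : Lip0 𝕜 X 𝕜) (φ : StrongDual 𝕜 E)
    (w : LipTensor 𝕜 X E), ‖w.1 (rankOne g φ)‖ ≤ lipConst g.1 * ‖φ‖ * nrm X E w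
  metric_mapping : ∀ (X₀ X₁ : Type u) [MetricSpace X₀] [Zero X₀] [MetricSpace X₁] [Zero X₁]
    (E₀ E₁ : Type v) [NormedAddCommGroup E₀] [NormedSpace 𝕜 E₀] [CompleteSpace E₀]
    [NormedAddCommGroup E₁] [NormedSpace 𝕜 E₁] [CompleteSpace E₁]
    (h : PLip X₀ X₁) (T : E₀ →L[𝕜] E₁) (w : LipTensor 𝕜 X₀ E₀),
    nrm X₁ E₁ (tmap h T w) ≤ lipConst h.1 * ‖T‖ * nrm X₀ E₀ w

namespace GenericCrossNorm

variable {𝕜 : Type} [RCLike 𝕜] (α : GenericCrossNorm.{u, v} 𝕜)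

/-- `α` is finitely generated: `α(w; X, E)` is the infimum of `α(w; X₀, E₀)` over all
`X₀ ∈ MFIN(X)` and `E₀ ∈ FIN(E)` with `w ∈ X₀ ⊠ E₀`, where `X₀ ⊠ E₀` sits in `X ⊠ E` through the
inclusions. -/
def IsFinitelyGenerated : Prop :=
  ∀ (X : Type u) [MetricSpace X] [Zero X] (E : Type v) [NormedAddCommGroup E]
    [NormedSpace 𝕜 E] [CompleteSpace E] (w : LipTensor 𝕜 X E),
    IsGLB {r : ℝ | ∃ (X₀ : MFin X) (E₀ : FinDim 𝕜 E) (w₀ : LipTensor 𝕜 X₀.Pt E₀.sub),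
      tmap X₀.incl E₀.sub.subtypeL w₀ = w ∧ α.nrm X₀.Pt E₀.sub w₀ = r} (α.nrm X E w)

/-- The completion `X ⊠̂_α E` of `X ⊠ E` for the norm `α`. -/
abbrev Completion (X : Type u) [MetricSpace X] [Zero X] (E : Type v) [NormedAddCommGroup E]
    [NormedSpace 𝕜 E] [CompleteSpace E] : Type (max u v) :=
  UniformSpace.Completion (α.nrm X E).Space

/-- The canonical map `X ⊠ E → X ⊠̂_α E`. -/
noncomputable def toCompletion {X : Type u} [MetricSpace X] [Zero X] {E : Type v}
    [NormedAddCommGroup E] [NormedSpace 𝕜 E] [CompleteSpace E] (w : LipTensor 𝕜 X E) :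
    α.Completion X E :=
  (((α.nrm X E).toSpace w : (α.nrm X E).Space) : UniformSpace.Completion (α.nrm X E).Space)

end GenericCrossNorm

/-! ## Generic Lipschitz operator Banach ideals -/

/-- A generic Lipschitz operator Banach ideal. -/
structure GenericIdeal (𝕜 : Type) [RCLike 𝕜] where
  sub : ∀ (X : Type u) [MetricSpace X] [Zero X] (E : Type v) [NormedAddCommGroup E]
    [NormedSpace 𝕜 E] [CompleteSpace E], Submodule 𝕜 (Lip0 𝕜 X E)
  nrm : ∀ (X : Type u) [MetricSpace X] [Zero X] (E : Type v) [NormedAddCommGroup E]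
    [NormedSpace 𝕜 E] [CompleteSpace E], VectorNorm 𝕜 (sub X E)
  rankOne_le : ∀ (X : Type u) [MetricSpace X] [Zero X] (E : Type v) [NormedAddCommGroup E]
    [NormedSpace 𝕜 E] [CompleteSpace E] (g : Lip0 𝕜 X 𝕜) (e : E),
    ∃ hm : rankOne g e ∈ sub X E, nrm X E ⟨rankOne g e, hm⟩ ≤ lipConst g.1 * ‖e‖
  lip_le : ∀ (X : Type u) [MetricSpace X] [Zero X] (E : Type v) [NormedAddCommGroup E]
    [NormedSpace 𝕜 E] [CompleteSpace E] (f : sub X E), lipConst f.1.1 ≤ nrm X E f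
  complete : ∀ (X : Type u) [MetricSpace X] [Zero X] (E : Type v) [NormedAddCommGroup E]
    [NormedSpace 𝕜 E] [CompleteSpace E], CompleteSpace (nrm X E).Space
  ideal : ∀ (Z X : Type u) [MetricSpace Z] [Zero Z] [MetricSpace X] [Zero X]
    (E F : Type v) [NormedAddCommGroup E] [NormedSpace 𝕜 E] [CompleteSpace E]
    [NormedAddCommGroup F] [NormedSpace 𝕜 F] [CompleteSpace F]
    (f : sub X E) (h : PLip Z X) (S : E →L[𝕜] F),
    ∃ hm : comp S h f.1 ∈ sub Z F, nrm Z F ⟨comp S h f.1, hm⟩ ≤ ‖S‖ * nrm X E f * lipConst h.1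

namespace GenericIdeal

variable {𝕜 : Type} [RCLike 𝕜] (A : GenericIdeal.{u, v} 𝕜)

open Classical in
/-- `‖f‖_A` with the convention `‖f‖_A = ∞` for `f ∉ A(X, E)`. -/
noncomputable def enorm {X : Type u} [MetricSpace X] [Zero X] {E : Type v} [NormedAddCommGroup E]
    [NormedSpace 𝕜 E] [CompleteSpace E] (f : Lip0 𝕜 X E) : ℝ≥0∞ :=
  if hf : f ∈ A.sub X E then ENNReal.ofReal (A.nrm X E ⟨f, hf⟩) else ⊤

/-- The Banach space `(A(X, E), ‖·‖_A)`. -/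
abbrev Space (X : Type u) [MetricSpace X] [Zero X] (E : Type v) [NormedAddCommGroup E]
    [NormedSpace 𝕜 E] [CompleteSpace E] : Type (max u v) :=
  (A.nrm X E).Space

/-- The identity map from `A(X, E)` to the Banach space `(A(X, E), ‖·‖_A)`. -/
def toSpace {X : Type u} [MetricSpace X] [Zero X] {E : Type v} [NormedAddCommGroup E]
    [NormedSpace 𝕜 E] [CompleteSpace E] : A.sub X E ≃ₗ[𝕜] A.Space X E :=
  (A.nrm X E).toSpace

/-- `‖f‖_{A^max}`: the supremum of `‖Q_L ∘ f ∘ I_Y‖_A` over `Y ∈ MFIN(X)` and `L ∈ COFIN(E)`. -/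
noncomputable def maxNorm {X : Type u} [MetricSpace X] [Zero X] {E : Type v}
    [NormedAddCommGroup E] [NormedSpace 𝕜 E] [CompleteSpace E] (f : Lip0 𝕜 X E) : ℝ≥0∞ :=
  ⨆ (Y : MFin X) (L : CoFin 𝕜 E), A.enorm (comp L.proj Y.incl f)

/-- `A` is maximal: `(A, ‖·‖_A) = (A^max, ‖·‖_{A^max})`, where
`A^max(X, E) = {f ∈ Lip₀(X, E) : ‖f‖_{A^max} < ∞}`. -/
def IsMaximal : Prop :=
  ∀ (X : Type u) [MetricSpace X] [Zero X] (E : Type v) [NormedAddCommGroup E]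
    [NormedSpace 𝕜 E] [CompleteSpace E] (f : Lip0 𝕜 X E),
    (f ∈ A.sub X E ↔ A.maxNorm f < ⊤) ∧
      ∀ hf : f ∈ A.sub X E, A.nrm X E ⟨f, hf⟩ = (A.maxNorm f).toReal

/-- `A(X, E) = (X ⊠̂_α E*)* ∩ Lip₀(X, E)` isometrically, where `f ∈ Lip₀(X, E)` is regarded as the
functional `u ↦ u(κ_E ∘ f)` on `X ⊠ E*`: `f` lies in `A(X, E)` if and only if this functional
extends to a continuous functional on the completion, and then the norms agree. -/
def RepresentedIn (α : GenericCrossNorm.{u, v} 𝕜) (X : Type u) [MetricSpace X] [Zero X]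
    (E : Type v) [NormedAddCommGroup E] [NormedSpace 𝕜 E] [CompleteSpace E] : Prop :=
  ∀ f : Lip0 𝕜 X E,
    (f ∈ A.sub X E ↔ ∃ Φ : StrongDual 𝕜 (α.Completion X (StrongDual 𝕜 E)),
      ∀ w : LipTensor 𝕜 X (StrongDual 𝕜 E), Φ (α.toCompletion w) =
        w.1 (comp (NormedSpace.inclusionInDoubleDual 𝕜 E) (PLip.id X) f)) ∧
    ∀ (hf : f ∈ A.sub X E) (Φ : StrongDual 𝕜 (α.Completion X (StrongDual 𝕜 E))),
      (∀ w : LipTensor 𝕜 X (StrongDual 𝕜 E), Φ (α.toCompletion w) =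
        w.1 (comp (NormedSpace.inclusionInDoubleDual 𝕜 E) (PLip.id X) f)) →
      A.nrm X E ⟨f, hf⟩ = ‖Φ‖

/-- `A(X, E*) = (X ⊠̂_α E)*` isometrically: `f ↦ (u ↦ u(f))` extends to a surjective linear isometry
from `A(X, E*)` onto the dual of the completion. -/
def DualRepresented (α : GenericCrossNorm.{u, v} 𝕜) (X : Type u) [MetricSpace X] [Zero X]
    (E : Type v) [NormedAddCommGroup E] [NormedSpace 𝕜 E] [CompleteSpace E] : Prop :=
  ∃ J : A.Space X (StrongDual 𝕜 E) ≃ₗᵢ[𝕜] StrongDual 𝕜 (α.Completion X E),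
    ∀ (f : A.sub X (StrongDual 𝕜 E)) (w : LipTensor 𝕜 X E),
      J (A.toSpace f) (α.toCompletion w) = w.1 f.1

end GenericIdeal

end LipschitzIdeals

/-! Everything is phrased through the predicate `NormLE`: f belongs to A and ‖f‖_A ≤ C. In these
terms (1) says that ‖f‖_A ≤ C exactly when |w(κ_E f)| ≤ C α(w) for all w in X ⊠ E*
(`representedIn_iff`), and maximality says that a common bound for all Q_L f I_Y passes to f
(`isMaximal_iff`).

Suppose α is finitely generated and represents A. Then f need only be tested on X₀ ⊠ M with X₀
finite and M ⊂ E* finite-dimensional. Such an M acts on E through E / M_⊥, so bounds on Q f I_{X₀}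
are enough, and A is maximal. For A(X, E*), condition (1) speaks of X ⊠ E**. Restricting a bound to
X ⊠ E is easy. Going back means passing from X ⊠ E to X₀ ⊠ M with M ⊂ E** finite-dimensional, which
is local reflexivity. Only a weak form is needed (`norm_sum_transpose_le`): functionals T ↦ ∑ φ_i(T
m_i) on L(M, E) do not gain norm on L(M, E**). A finite net embeds L(M, E) almost isometrically in a
finite ℓ_∞-sum of copies of E, and Hahn–Banach then gives a representation of ∑ m_i ⊗ φ_i of small
projective norm.

Conversely, for A maximal, let α(w; X, E) be the supremum of |w(f)| over the unit ball of A(X, E*)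
(`dualCrossNorm`). For finite Y and finite-dimensional G the duality is perfect
(`normLE_of_finite`), and maximality spreads this to (1). For finite generation, α is compared with
its finite hull. By Hahn–Banach, w is normed by some f dominated by the hull. Local reflexivity and
finite duality give ‖Q_L f I_Y‖_A ≤ 1, maximality puts f in the unit ball of A(X, E*), and so the
hull is at most α. -/

namespace LipschitzIdeals

/-! ### Least Lipschitz constants and finite pointed subsets. -/

section LipConst

variable {X Y : Type*} [MetricSpace X] [MetricSpace Y]

theorem lipConst_le {f : X → Y} {C : ℝ} (hC : 0 ≤ C)
    (h : ∀ x y, dist (f x) (f y) ≤ C * dist x y) : lipConst f ≤ C :=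
  csInf_le ⟨0, fun _ hr => hr.1⟩ ⟨hC, h⟩

theorem lipConst_nonneg (f : X → Y) : 0 ≤ lipConst f :=
  Real.sInf_nonneg fun _ hr => hr.1

/-- The infimum defining `lipConst` is attained: for x ≠ y every admissible constant is at least the
difference quotient at x, y. -/
theorem dist_le_lipConst_mul {f : X → Y} (hf : ∃ K : ℝ≥0, LipschitzWith K f) (x y : X) :
    dist (f x) (f y) ≤ lipConst f * dist x y := by
  rcases eq_or_ne x y with rfl | hxy
  · simp
  · have hd : 0 < dist x y := dist_pos.2 hxy
    rw [← div_le_iff₀ hd]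
    obtain ⟨K, hK⟩ := hf
    refine le_csInf ⟨K, K.2, hK.dist_le_mul⟩ fun C hC => ?_
    rw [div_le_iff₀ hd]
    exact hC.2 x y

end LipConst

/-- Composition of base-point preserving Lipschitz maps. -/
def PLip.trans {X Y Z : Type*} [MetricSpace X] [Zero X] [MetricSpace Y] [Zero Y] [MetricSpace Z]
    [Zero Z] (h : PLip X Y) (k : PLip Y Z) : PLip X Z :=
  ⟨fun x => k.1 (h.1 x), by
    obtain ⟨h, hh, M, hM⟩ := h
    obtain ⟨k, hk, K, hK⟩ := k
    exact ⟨by simp [hh, hk], K * M, hK.comp hM⟩⟩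

theorem lipConst_id_le (X : Type*) [MetricSpace X] [Zero X] : lipConst (PLip.id X).1 ≤ 1 :=
  lipConst_le zero_le_one fun x y => by simp [PLip.id]

theorem MFin.lipConst_incl_le {X : Type u} [MetricSpace X] [Zero X] (Y : MFin X) :
    lipConst Y.incl.1 ≤ 1 :=
  lipConst_le zero_le_one fun x y => by rw [one_mul]; exact le_refl _

/-- The inclusion between finite pointed subsets. -/
def MFin.inclOfLE {X : Type u} [MetricSpace X] [Zero X] {Y Z : MFin X} (h : Y.set ⊆ Z.set) :
    PLip Y.Pt Z.Pt :=
  ⟨Set.inclusion h, rfl, 1, LipschitzWith.of_dist_le_mul fun x y => by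
    rw [NNReal.coe_one, one_mul]; exact le_refl _⟩

theorem MFin.lipConst_inclOfLE_le {X : Type u} [MetricSpace X] [Zero X] {Y Z : MFin X}
    (h : Y.set ⊆ Z.set) : lipConst (MFin.inclOfLE h).1 ≤ 1 :=
  lipConst_le zero_le_one fun x y => by rw [one_mul]; exact le_refl _

instance {X : Type u} [MetricSpace X] [Zero X] (Y : MFin X) : Finite Y.Pt := Y.finite

/-! ### Elementary tensors and linear functionals on X ⊠ E. -/

section Tensor

variable {𝕜 : Type} [RCLike 𝕜] {X Y Z : Type*} [MetricSpace X] [Zero X] [MetricSpace Y] [Zero Y]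
  [MetricSpace Z] [Zero Z]
  {E F G : Type*} [NormedAddCommGroup E] [NormedSpace 𝕜 E] [NormedAddCommGroup F]
  [NormedSpace 𝕜 F] [NormedAddCommGroup G] [NormedSpace 𝕜 G]

theorem Lip0.dist_le (f : Lip0 𝕜 X E) (x y : X) :
    dist (f.1 x) (f.1 y) ≤ lipConst f.1 * dist x y :=
  dist_le_lipConst_mul f.2.2 x y

theorem norm_adj_le (T : E →L[𝕜] F) : ‖adj T‖ ≤ ‖T‖ := by
  refine ContinuousLinearMap.opNorm_le_bound _ (norm_nonneg _) fun φ => ?_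
  rw [mul_comm]
  exact ContinuousLinearMap.opNorm_comp_le φ T

@[simp] theorem rankOne_apply (g : Lip0 𝕜 X 𝕜) (e : E) (x : X) :
    (rankOne g e).1 x = g.1 x • e := rfl

@[simp] theorem delta_apply (x y : X) (e : E) (f : Lip0 𝕜 X (StrongDual 𝕜 E)) :
    (delta 𝕜 x y e).1 f = (f.1 x - f.1 y) e := rfl

@[simp] theorem tmap_apply (h : PLip X Y) (T : E →L[𝕜] F) (w : LipTensor 𝕜 X E)
    (f : Lip0 𝕜 Y (StrongDual 𝕜 F)) : (tmap h T w).1 f = w.1 (comp (adj T) h f) := rfl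

theorem tmap_tmap (h : PLip X Y) (k : PLip Y Z) (T : E →L[𝕜] F) (S : F →L[𝕜] G)
    (w : LipTensor 𝕜 X E) : tmap k S (tmap h T w) = tmap (h.trans k) (S.comp T) w := rfl

theorem delta_smul (c : 𝕜) (x y : X) (e : E) : delta 𝕜 x y (c • e) = c • delta 𝕜 x y e := by
  apply Subtype.ext
  ext f
  simp

theorem delta_add (x y : X) (e e' : E) :
    delta 𝕜 x y (e + e') = delta 𝕜 x y e + delta 𝕜 x y e' := by
  apply Subtype.ext
  ext f
  change (f.1 x - f.1 y) (e + e') = (f.1 x - f.1 y) e + (f.1 x - f.1 y) e'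
  exact map_add _ _ _

theorem delta_sub_delta (x y : X) (e : E) :
    delta 𝕜 x 0 e - delta 𝕜 y 0 e = delta 𝕜 x y e := by
  apply Subtype.ext
  ext f
  change (f.1 x - f.1 0) e - (f.1 y - f.1 0) e = (f.1 x - f.1 y) e
  simp

/-- Every element of `X ⊠ E` is a finite sum of elementary tensors. -/
theorem LipTensor.exists_sum (w : LipTensor 𝕜 X E) :
    ∃ (ι : Type) (_ : Fintype ι) (x y : ι → X) (e : ι → E),
      w = ∑ i, delta 𝕜 (x i) (y i) (e i) := by
  obtain ⟨w, hw⟩ := w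
  refine Submodule.span_induction (p := fun w hw => ∃ (ι : Type) (_ : Fintype ι) (x y : ι → X)
    (e : ι → E), (⟨w, hw⟩ : LipTensor 𝕜 X E) = ∑ i, delta 𝕜 (x i) (y i) (e i)) ?_ ?_ ?_ ?_ hw
  · rintro _ ⟨⟨x, y, e⟩, rfl⟩
    exact ⟨Unit, inferInstance, fun _ => x, fun _ => y, fun _ => e, by simp [delta]⟩
  · exact ⟨Empty, inferInstance, Empty.elim, Empty.elim, Empty.elim,
      by rw [Finset.univ_eq_empty, Finset.sum_empty]; rfl⟩
  · rintro a b ha hb ⟨ι, _, x, y, e, h⟩ ⟨κ, _, x', y', e', h'⟩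
    refine ⟨ι ⊕ κ, inferInstance, Sum.elim x x', Sum.elim y y', Sum.elim e e', ?_⟩
    simp only [Fintype.sum_sum_type, Sum.elim_inl, Sum.elim_inr]
    rw [← h, ← h']
    rfl
  · rintro c a ha ⟨ι, _, x, y, e, h⟩
    refine ⟨ι, inferInstance, x, y, fun i => c • e i, ?_⟩
    simp only [delta_smul]
    rw [← Finset.smul_sum, ← h]
    rfl

theorem sum_delta_apply {ι : Type*} (s : Finset ι) (x y : ι → X) (e : ι → E)
    (f : Lip0 𝕜 X (StrongDual 𝕜 E)) :
    (∑ i ∈ s, delta 𝕜 (x i) (y i) (e i)).1 f = ∑ i ∈ s, (f.1 (x i) - f.1 (y i)) (e i) := by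
  simp

/-- A linear functional on `X ⊠ E` dominated by `C d(x,y) ‖e‖` on elementary tensors is evaluation
at an element of `Lip₀(X, E*)`. -/
theorem LipTensor.exists_lip_of_bound (φ : LipTensor 𝕜 X E →ₗ[𝕜] 𝕜) {C : ℝ} (hC : 0 ≤ C)
    (h : ∀ x y e, ‖φ (delta 𝕜 x y e)‖ ≤ C * (dist x y * ‖e‖)) :
    ∃ f : Lip0 𝕜 X (StrongDual 𝕜 E), ∀ w : LipTensor 𝕜 X E, w.1 f = φ w := by
  -- The choice is forced: since f(0) = 0, evaluating δ_(x,0) ⊠ e at f gives f(x)(e).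
  let F : X → StrongDual 𝕜 E := fun x => LinearMap.mkContinuous
    { toFun := fun e => φ (delta 𝕜 x 0 e)
      map_add' := fun a b => by rw [delta_add, map_add]
      map_smul' := fun c a => by rw [delta_smul, map_smul]; rfl } (C * dist x 0)
    fun e => by simpa [mul_assoc] using h x 0 e
  have hF : ∀ x e, F x e = φ (delta 𝕜 x 0 e) := fun _ _ => rfl
  have hd : ∀ x y e, (F x - F y) e = φ (delta 𝕜 x y e) := fun x y e => by
    rw [sub_apply, hF, hF, ← map_sub, delta_sub_delta]
  have h0 : F 0 = 0 := by
    ext e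
    have := h 0 0 e
    rw [dist_self, zero_mul, mul_zero] at this
    rw [hF]
    simpa using this
  refine ⟨⟨F, h0, C.toNNReal, LipschitzWith.of_dist_le_mul fun x y => ?_⟩, fun w => ?_⟩
  · rw [dist_eq_norm, Real.coe_toNNReal _ hC]
    refine ContinuousLinearMap.opNorm_le_bound _ (by positivity) fun e => ?_
    rw [hd, mul_assoc]
    exact h x y e
  · obtain ⟨ι, _, x, y, e, rfl⟩ := LipTensor.exists_sum w
    rw [sum_delta_apply, map_sum]
    exact Finset.sum_congr rfl fun i _ => hd _ _ _

end Tensor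


/-! ### A weak principle of local reflexivity. -/

section LocalReflexivity

variable {𝕜 : Type*} [RCLike 𝕜] {M E : Type*} [NormedAddCommGroup M] [NormedSpace 𝕜 M]
  [NormedAddCommGroup E] [NormedSpace 𝕜 E]

/-- A linear functional dominated by the norm of a linear map `R` factors through `R`, with control
of the norm. -/
theorem exists_strongDual_comp_eq {W Z : Type*} [AddCommGroup W] [Module 𝕜 W]
    [NormedAddCommGroup Z] [NormedSpace 𝕜 Z] (R : W →ₗ[𝕜] Z) (l : W →ₗ[𝕜] 𝕜) {C : ℝ}
    (hC : 0 ≤ C) (h : ∀ w, ‖l w‖ ≤ C * ‖R w‖) :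
    ∃ l' : StrongDual 𝕜 Z, ‖l'‖ ≤ C ∧ ∀ w, l' (R w) = l w := by
  have hker : LinearMap.ker R ≤ LinearMap.ker l := fun w hw => by
    have := h w
    rw [LinearMap.mem_ker.1 hw, norm_zero, mul_zero] at this
    simpa using this
  let l₀ : LinearMap.range R →ₗ[𝕜] 𝕜 :=
    (LinearMap.ker R).liftQ l hker ∘ₗ R.quotKerEquivRange.symm.toLinearMap
  have hl₀ : ∀ w, l₀ ⟨R w, LinearMap.mem_range_self R w⟩ = l w := fun w => by
    have : R.quotKerEquivRange.symm ⟨R w, LinearMap.mem_range_self R w⟩ =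
        (LinearMap.ker R).mkQ w := by
      rw [LinearEquiv.symm_apply_eq]
      rfl
    simp [l₀, this]
  have hb : ∀ z, ‖l₀ z‖ ≤ C * ‖z‖ := by
    rintro ⟨_, w, rfl⟩
    rw [hl₀]
    exact h w
  obtain ⟨l', hl', hn⟩ := exists_extension_norm_eq (𝕜 := 𝕜) (LinearMap.range R)
    (l₀.mkContinuous C hb)
  refine ⟨l', hn.trans_le (LinearMap.mkContinuous_norm_le _ hC _), fun w => ?_⟩
  rw [← hl₀ w]
  exact hl' ⟨R w, LinearMap.mem_range_self R w⟩

/-- The components of a functional on a finite `ℓ_∞`-sum have `ℓ_1`-norm at most the norm. -/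
theorem sum_norm_comp_single_le {κ : Type*} [Fintype κ] [DecidableEq κ]
    (l : StrongDual 𝕜 (κ → E)) :
    ∑ k, ‖l.comp (ContinuousLinearMap.single 𝕜 (fun _ : κ => E) k)‖ ≤ ‖l‖ := by
  set χ : κ → StrongDual 𝕜 E := fun k => l.comp (ContinuousLinearMap.single 𝕜 (fun _ : κ => E) k)
    with hχ
  have key : ∀ δ > 0, ∑ k, ‖χ k‖ ≤ ‖l‖ + Fintype.card κ * δ := by
    intro δ hδ
    -- A vector nearly norming χ_k is rotated by a unimodular scalar, so that the values χ_k(e_k)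
    -- are real and add up without cancellation.
    have h1 : ∀ k, ∃ e : E, ‖e‖ ≤ 1 ∧ ‖χ k‖ - δ ≤ RCLike.re (χ k e) := by
      intro k
      obtain ⟨e, he, hr⟩ := (χ k).exists_lt_apply_of_lt_opNorm (sub_lt_self ‖χ k‖ hδ)
      obtain ⟨c, hc, hce⟩ := RCLike.exists_norm_mul_eq_self (χ k e)
      rcases eq_or_ne (χ k e) 0 with h0 | h0
      · refine ⟨0, by simp, ?_⟩
        rw [h0, norm_zero] at hr
        simpa using hr.le
      · obtain ⟨c, hc, hce⟩ : ∃ c : 𝕜, ‖c‖ = 1 ∧ c * χ k e = (‖χ k e‖ : 𝕜) := by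
          refine ⟨(‖χ k e‖ : 𝕜) / χ k e, ?_, ?_⟩
          · rw [norm_div, RCLike.norm_ofReal, abs_norm, div_self (norm_ne_zero_iff.2 h0)]
          · exact div_mul_cancel₀ _ h0
        refine ⟨c • e, by rw [norm_smul, hc, one_mul]; exact he.le, ?_⟩
        rw [map_smul, smul_eq_mul, hce, RCLike.ofReal_re]
        exact hr.le
    choose e he hr using h1
    have h2 : l e = ∑ k, χ k (e k) := by
      conv_lhs => rw [← Finset.univ_sum_single e]
      rw [map_sum]
      rfl
    have h3 : ‖e‖ ≤ 1 := (pi_norm_le_iff_of_nonneg zero_le_one).2 he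
    calc ∑ k, ‖χ k‖ ≤ ∑ k, (RCLike.re (χ k (e k)) + δ) :=
          Finset.sum_le_sum fun k _ => by linarith [hr k]
      _ = RCLike.re (l e) + Fintype.card κ * δ := by
          rw [Finset.sum_add_distrib, h2, map_sum]; simp
      _ ≤ ‖l‖ + Fintype.card κ * δ := by
          gcongr
          calc RCLike.re (l e) ≤ ‖l e‖ := RCLike.re_le_norm _
            _ ≤ ‖l‖ * ‖e‖ := l.le_opNorm e
            _ ≤ ‖l‖ := mul_le_of_le_one_right (norm_nonneg _) h3
  refine le_of_forall_pos_le_add fun ε hε => ?_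
  refine (key (ε / (Fintype.card κ + 1)) (by positivity)).trans ?_
  gcongr
  rw [mul_div_assoc', div_le_iff₀ (by positivity)]
  nlinarith

variable [FiniteDimensional 𝕜 M]

/-- The operator norm on a finite-dimensional space is nearly attained on a finite subset of the
unit ball. -/
theorem exists_finset_opNorm_le (M E : Type*) [NormedAddCommGroup M] [NormedSpace 𝕜 M]
    [NormedAddCommGroup E] [NormedSpace 𝕜 E] [FiniteDimensional 𝕜 M] {ε : ℝ} (hε : 0 < ε) :
    ∃ t : Finset M, (∀ m ∈ t, ‖m‖ ≤ 1) ∧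
      ∀ T : M →L[𝕜] E, (1 - ε) * ‖T‖ ≤ ‖fun m : t => T m‖ := by
  have : ProperSpace M := FiniteDimensional.proper_rclike 𝕜 M
  -- t is an ε-net of the unit ball. Moving to the nearest net point costs at most ‖T‖ε, which is
  -- absorbed on the left.
  obtain ⟨t, hts, htf, htc⟩ :=
    (isCompact_closedBall (0 : M) 1).finite_cover_balls hε
  lift t to Finset M using htf
  refine ⟨t, fun m hm => by simpa using hts hm, fun T => ?_⟩
  have h : ‖T‖ ≤ ‖fun m : t => T m‖ + ‖T‖ * ε := by
    refine ContinuousLinearMap.opNorm_le_of_unit_norm (by positivity) fun m hm => ?_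
    obtain ⟨m', hm', hd⟩ := Set.mem_iUnion₂.1 (htc (show m ∈ Metric.closedBall (0 : M) 1 by
      simp [hm]))
    have hsub : ‖T (m - m')‖ ≤ ‖T‖ * ε := by
      refine (T.le_opNorm _).trans ?_
      gcongr
      rw [← dist_eq_norm]
      exact (Metric.mem_ball.1 hd).le
    calc ‖T m‖ = ‖T m' + T (m - m')‖ := by rw [← map_add]; simp
      _ ≤ ‖T m'‖ + ‖T (m - m')‖ := norm_add_le _ _
      _ ≤ _ := by
        gcongr
        exact norm_le_pi_norm (fun m : t => T m) ⟨m', hm'⟩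
  linarith

/-- Weak form of the principle of local reflexivity: for `M` finite-dimensional, the functionals
`T ↦ ∑ φ_i (T m_i)` on `L(M, E)` keep their norm on `L(M, E**)`. An operator `M → E**` is given by
its transpose `E* → M*`. -/
theorem norm_sum_transpose_le {ι : Type*} [Fintype ι] (m : ι → M) (φ : ι → StrongDual 𝕜 E)
    {N : ℝ} (hN : 0 ≤ N) (h : ∀ T : M →L[𝕜] E, ‖∑ i, φ i (T (m i))‖ ≤ N * ‖T‖)
    (J : StrongDual 𝕜 E →L[𝕜] StrongDual 𝕜 M) :
    ‖∑ i, J (φ i) (m i)‖ ≤ N * ‖J‖ := by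
  classical
  have key : ∀ ε : ℝ, 0 < ε → ε < 1 → (1 - ε) * ‖∑ i, J (φ i) (m i)‖ ≤ N * ‖J‖ := by
    intro ε hε hε1
    have hε' : 0 < 1 - ε := sub_pos.2 hε1
    obtain ⟨t, ht1, ht⟩ := exists_finset_opNorm_le (𝕜 := 𝕜) M E hε
    let R : (M →L[𝕜] E) →ₗ[𝕜] (t → E) :=
      { toFun := fun T k => T k, map_add' := fun _ _ => rfl, map_smul' := fun _ _ => rfl }
    let l : (M →L[𝕜] E) →ₗ[𝕜] 𝕜 :=
      { toFun := fun T => ∑ i, φ i (T (m i))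
        map_add' := fun _ _ => by simp [Finset.sum_add_distrib]
        map_smul' := fun _ _ => by simp [Finset.mul_sum] }
    -- Evaluation on the net satisfies (1 - ε)‖T‖ ≤ ‖R T‖, so l factors through R at the cost of the
    -- factor 1 / (1 - ε).
    obtain ⟨l', hl', hfac⟩ := exists_strongDual_comp_eq R l (C := N / (1 - ε)) (by positivity)
      (fun T => by
        refine (h T).trans ?_
        rw [div_mul_eq_mul_div, le_div_iff₀ hε', mul_assoc, mul_comm ‖T‖]
        gcongr
        exact ht T)
    let χ : t → StrongDual 𝕜 E := fun k =>
      l'.comp (ContinuousLinearMap.single 𝕜 (fun _ : t => E) k)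
    have hχ : ∑ k, ‖χ k‖ ≤ N / (1 - ε) := (sum_norm_comp_single_le l').trans hl'
    have hsum : ∀ T : M →L[𝕜] E, ∑ k : t, χ k (T k) = ∑ i, φ i (T (m i)) := fun T => by
      refine Eq.trans ?_ (hfac T)
      conv_rhs => rw [← Finset.univ_sum_single (R T)]
      rw [map_sum]
      rfl
    -- Rank-one operators T = μ ⊗ e show that ∑ k ⊗ χ_k and ∑ m_i ⊗ φ_i are the same tensor in M ⊗
    -- E*.
    have hmu : ∀ μ : StrongDual 𝕜 M, ∑ k : t, μ k • χ k = ∑ i, μ (m i) • φ i := fun μ => by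
      ext e
      have := hsum (μ.smulRight e)
      simpa using this
    let b := Module.finBasis 𝕜 M
    let b' : Fin (Module.finrank 𝕜 M) → StrongDual 𝕜 M := fun j =>
      (b.coord j).toContinuousLinearMap
    -- Expanding in a basis of M shows that the pairing with J depends only on that tensor, so the
    -- m_i, φ_i may be replaced by the net points and the χ_k.
    have hJ : ∀ ψ x, J ψ x = ∑ j, b' j x * J ψ (b j) := fun ψ x => by
      conv_lhs => rw [← b.sum_repr x]
      rw [map_sum]
      exact Finset.sum_congr rfl fun j _ => map_smul _ _ _
    have hJt : ∑ k : t, J (χ k) k = ∑ j, J (∑ k : t, b' j k • χ k) (b j) := by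
      rw [Finset.sum_congr rfl fun (k : t) _ => hJ (χ k) k, Finset.sum_comm]
      refine Finset.sum_congr rfl fun j _ => ?_
      simp [sum_apply]
    have hJm : ∑ i, J (φ i) (m i) = ∑ j, J (∑ i, b' j (m i) • φ i) (b j) := by
      rw [Finset.sum_congr rfl fun i _ => hJ (φ i) (m i), Finset.sum_comm]
      refine Finset.sum_congr rfl fun j _ => ?_
      simp [sum_apply]
    have heq : ∑ k : t, J (χ k) k = ∑ i, J (φ i) (m i) := by
      rw [hJt, hJm]
      simp_rw [hmu]
    rw [← heq]
    calc (1 - ε) * ‖∑ k : t, J (χ k) k‖ ≤ (1 - ε) * ∑ k : t, ‖J‖ * ‖χ k‖ := by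
          gcongr
          refine norm_sum_le_of_le _ fun k _ => ?_
          calc ‖J (χ k) k‖ ≤ ‖J‖ * ‖χ k‖ * ‖(k : M)‖ := J.le_opNorm₂ _ _
            _ ≤ ‖J‖ * ‖χ k‖ * 1 := by gcongr; exact ht1 k k.2
            _ = ‖J‖ * ‖χ k‖ := mul_one _
      _ ≤ (1 - ε) * (‖J‖ * (N / (1 - ε))) := by rw [← Finset.mul_sum]; gcongr
      _ = N * ‖J‖ := by field_simp
  have hlim : Filter.Tendsto (fun ε : ℝ => (1 - ε) * ‖∑ i, J (φ i) (m i)‖)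
      (nhdsWithin 0 (Set.Ioi 0)) (nhds ((1 - 0) * ‖∑ i, J (φ i) (m i)‖)) :=
    ((continuous_const.sub continuous_id).mul continuous_const).continuousWithinAt
  rw [sub_zero, one_mul] at hlim
  refine le_of_tendsto hlim ?_
  filter_upwards [Ioo_mem_nhdsGT (zero_lt_one' ℝ)] with ε hε using key ε hε.1 hε.2

end LocalReflexivity


section Tensor

variable {𝕜 : Type} [RCLike 𝕜] {X : Type*} [MetricSpace X] [Zero X]
  {M E : Type*} [NormedAddCommGroup M] [NormedSpace 𝕜 M] [NormedAddCommGroup E] [NormedSpace 𝕜 E]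

/-- Local reflexivity, in the language of Lipschitz tensor products. -/
theorem LipTensor.norm_apply_comp_le [FiniteDimensional 𝕜 M] (w : LipTensor 𝕜 X M)
    (f : Lip0 𝕜 X (StrongDual 𝕜 E)) {N : ℝ} (hN : 0 ≤ N)
    (h : ∀ T : M →L[𝕜] E, ‖(tmap (PLip.id X) T w).1 f‖ ≤ N * ‖T‖)
    (J : StrongDual 𝕜 E →L[𝕜] StrongDual 𝕜 M) :
    ‖w.1 (comp J (PLip.id X) f)‖ ≤ N * ‖J‖ := by
  obtain ⟨ι, _, x, y, m, rfl⟩ := LipTensor.exists_sum w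
  have := norm_sum_transpose_le m (fun i => f.1 (x i) - f.1 (y i)) hN (fun T => by
    have hT := h T
    rw [tmap_apply, sum_delta_apply] at hT
    exact hT) J
  rw [sum_delta_apply]
  refine le_of_eq_of_le ?_ this
  congr 1
  refine Finset.sum_congr rfl fun i _ => ?_
  rw [map_sub]
  rfl

/-- `Lip₀(X, D*)`. -/
abbrev LipDual (𝕜 : Type) [RCLike 𝕜] (X D : Type*) [MetricSpace X] [Zero X]
    [NormedAddCommGroup D] [NormedSpace 𝕜 D] : Type _ :=
  Lip0 𝕜 X (StrongDual 𝕜 D)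

/-- Evaluation at `f`, as a linear functional on `X ⊠ D`. -/
noncomputable def evalₗ {𝕜 : Type} [RCLike 𝕜] {X D : Type*} [MetricSpace X] [Zero X]
    [NormedAddCommGroup D] [NormedSpace 𝕜 D] (f : LipDual 𝕜 X D) : LipTensor 𝕜 X D →ₗ[𝕜] 𝕜 where
  toFun w := w.1 f
  map_add' _ _ := rfl
  map_smul' _ _ := rfl

/-- The map `κ_E ∘ f` for `f ∈ Lip₀(X, E)`. -/
noncomputable def toBidual (f : Lip0 𝕜 X E) : LipDual 𝕜 X (StrongDual 𝕜 E) :=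
  comp (NormedSpace.inclusionInDoubleDual 𝕜 E) (PLip.id X) f

theorem CoFin.norm_proj_le (L : CoFin 𝕜 E) : ‖L.proj‖ ≤ 1 :=
  ContinuousLinearMap.opNorm_le_bound _ zero_le_one fun x => by
    rw [one_mul]; exact Submodule.Quotient.norm_mk_le _ x

end Tensor

/-! ### Extending functionals to a completion. -/

section Extension

variable {𝕜 W Z : Type*} [RCLike 𝕜] [AddCommGroup W] [Module 𝕜 W] [NormedAddCommGroup Z]
  [NormedSpace 𝕜 Z]

omit [AddCommGroup W] [Module 𝕜 W] in
theorem opNorm_le_of_denseRange {i : W → Z} (hi : DenseRange i) {N : W → ℝ}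
    (hN : ∀ w, ‖i w‖ = N w) (Φ : StrongDual 𝕜 Z) {C : ℝ} (hC : 0 ≤ C)
    (h : ∀ w, ‖Φ (i w)‖ ≤ C * N w) : ‖Φ‖ ≤ C := by
  refine ContinuousLinearMap.opNorm_le_bound _ hC fun z => ?_
  refine hi.induction_on z ?_ fun w => ?_
  · exact isClosed_le Φ.continuous.norm (continuous_const.mul continuous_norm)
  · rw [hN]
    exact h w

/-- Removes the completion from (1): by density the norm of an extension is the least C with |l| ≤ C
N, so an isometric statement amounts to having the same admissible constants. Taking C to be the
norm itself recovers equality of norms. -/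
theorem strongDual_extension_iff (i : W →ₗ[𝕜] Z) (hi : DenseRange i) (N : W → ℝ)
    (hN : ∀ w, ‖i w‖ = N w) (l : W →ₗ[𝕜] 𝕜) {P : Prop} (n : P → ℝ) (hn : ∀ h, 0 ≤ n h) :
    ((P ↔ ∃ Φ : StrongDual 𝕜 Z, ∀ w, Φ (i w) = l w) ∧
      ∀ (h : P) (Φ : StrongDual 𝕜 Z), (∀ w, Φ (i w) = l w) → n h = ‖Φ‖) ↔
    ∀ C : ℝ, 0 ≤ C → ((∃ h : P, n h ≤ C) ↔ ∀ w, ‖l w‖ ≤ C * N w) := by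
  have hN0 : ∀ w, 0 ≤ N w := fun w => (norm_nonneg (i w)).trans_eq (hN w)
  have hext : ∀ C : ℝ, 0 ≤ C → (∀ w, ‖l w‖ ≤ C * N w) →
      ∃ Φ : StrongDual 𝕜 Z, ‖Φ‖ ≤ C ∧ ∀ w, Φ (i w) = l w := fun C hC h =>
    exists_strongDual_comp_eq i l hC fun w => (h w).trans_eq (by rw [hN])
  have hb : ∀ Φ : StrongDual 𝕜 Z, (∀ w, Φ (i w) = l w) → ∀ w, ‖l w‖ ≤ ‖Φ‖ * N w := fun Φ hΦ w => by
    rw [← hΦ w, ← hN]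
    exact Φ.le_opNorm _
  constructor
  · rintro ⟨h1, h2⟩ C hC
    constructor
    · rintro ⟨h, hle⟩ w
      obtain ⟨Φ, hΦ⟩ := h1.1 h
      refine (hb Φ hΦ w).trans ?_
      rw [← h2 h Φ hΦ]
      exact mul_le_mul_of_nonneg_right hle (hN0 w)
    · intro h
      obtain ⟨Φ, hle, hΦ⟩ := hext C hC h
      exact ⟨h1.2 ⟨Φ, hΦ⟩, (h2 _ Φ hΦ).trans_le hle⟩
  · intro h
    have key : ∀ Φ : StrongDual 𝕜 Z, (∀ w, Φ (i w) = l w) → ∃ h : P, n h ≤ ‖Φ‖ :=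
      fun Φ hΦ => (h _ (norm_nonneg Φ)).2 (hb Φ hΦ)
    refine ⟨⟨fun hP => ?_, fun ⟨Φ, hΦ⟩ => (key Φ hΦ).1⟩, fun hP Φ hΦ => ?_⟩
    · obtain ⟨Φ, -, hΦ⟩ := hext _ (hn hP) ((h _ (hn hP)).1 ⟨hP, le_rfl⟩)
      exact ⟨Φ, hΦ⟩
    · refine le_antisymm (key Φ hΦ).2 (opNorm_le_of_denseRange hi hN Φ (hn hP) fun w => ?_)
      rw [hΦ w]
      exact (h _ (hn hP)).1 ⟨hP, le_rfl⟩ w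

/-- A subspace `A` of a space of functionals on `W`, normed by the dual norm and exhausting the
bounded functionals, is the dual of the completion. -/
theorem exists_linearIsometryEquiv_strongDual {B : Type*} [NormedAddCommGroup B] [NormedSpace 𝕜 B]
    (i : W →ₗ[𝕜] Z) (hi : DenseRange i) (N : W → ℝ) (hN : ∀ w, ‖i w‖ = N w)
    (e : B →ₗ[𝕜] W →ₗ[𝕜] 𝕜) (hle : ∀ b w, ‖e b w‖ ≤ ‖b‖ * N w)
    (hsurj : ∀ (l : W →ₗ[𝕜] 𝕜) (C : ℝ), 0 ≤ C → (∀ w, ‖l w‖ ≤ C * N w) →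
      ∃ b, ‖b‖ ≤ C ∧ e b = l) (hinj : Function.Injective e) :
    ∃ J : B ≃ₗᵢ[𝕜] StrongDual 𝕜 Z, ∀ b w, J b (i w) = e b w := by
  have hext : ∀ b, ∃ Φ : StrongDual 𝕜 Z, ‖Φ‖ ≤ ‖b‖ ∧ ∀ w, Φ (i w) = e b w := fun b =>
    exists_strongDual_comp_eq i (e b) (norm_nonneg b) fun w => (hle b w).trans_eq (by rw [hN])
  choose J hJn hJ using hext
  have huniq : ∀ Φ Ψ : StrongDual 𝕜 Z, (∀ w, Φ (i w) = Ψ (i w)) → Φ = Ψ := fun Φ Ψ h =>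
    DFunLike.coe_injective (hi.equalizer Φ.continuous Ψ.continuous (funext h))
  have hrep : ∀ Φ : StrongDual 𝕜 Z, ∃ b, ‖b‖ ≤ ‖Φ‖ ∧ J b = Φ := fun Φ => by
    obtain ⟨b, hb, he⟩ := hsurj (Φ.toLinearMap.comp i) ‖Φ‖ (norm_nonneg _) fun w => by
      rw [← hN]; exact Φ.le_opNorm _
    exact ⟨b, hb, huniq _ _ fun w => by rw [hJ, he]; rfl⟩
  let Jl : B →ₗᵢ[𝕜] StrongDual 𝕜 Z :=
    { toFun := J
      map_add' := fun a b => huniq _ _ fun w => by simp [hJ]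
      map_smul' := fun c b => huniq _ _ fun w => by simp [hJ]
      norm_map' := fun b => by
        refine le_antisymm (hJn b) ?_
        -- Exhaustion yields some b' with the same functional and ‖b'‖ ≤ ‖J b‖. Injectivity forces
        -- b' = b, which gives the missing inequality.
        obtain ⟨b', hb', he⟩ := hrep (J b)
        have : b' = b := hinj (LinearMap.ext fun w => by rw [← hJ, ← hJ, he])
        rw [← this]
        rw [this] at hb' ⊢
        exact hb' }
  refine ⟨LinearIsometryEquiv.ofSurjective Jl fun Φ => ?_, hJ⟩
  obtain ⟨b, -, hb⟩ := hrep Φ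
  exact ⟨b, hb⟩

end Extension

/-! ### Bounds for generic and finitely generated cross-norms. -/

namespace GenericCrossNorm

variable {𝕜 : Type} [RCLike 𝕜] (α : GenericCrossNorm.{u, v} 𝕜)

section

variable {X : Type u} [MetricSpace X] [Zero X] {E : Type v} [NormedAddCommGroup E]
  [NormedSpace 𝕜 E] [CompleteSpace E]

theorem nrm_nonneg (w : LipTensor 𝕜 X E) : 0 ≤ α.nrm X E w := apply_nonneg _ _

theorem norm_toCompletion (w : LipTensor 𝕜 X E) : ‖α.toCompletion w‖ = α.nrm X E w :=
  UniformSpace.Completion.norm_coe _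

theorem toCompletion_add (w z : LipTensor 𝕜 X E) :
    α.toCompletion (w + z) = α.toCompletion w + α.toCompletion z :=
  UniformSpace.Completion.coe_add _ _

theorem toCompletion_smul (c : 𝕜) (w : LipTensor 𝕜 X E) :
    α.toCompletion (c • w) = c • α.toCompletion w :=
  UniformSpace.Completion.coe_smul c ((α.nrm X E).toSpace w)

/-- The canonical map `X ⊠ E → X ⊠̂_α E`, as a linear map. -/
noncomputable def toCompletionₗ : LipTensor 𝕜 X E →ₗ[𝕜] α.Completion X E where
  toFun := α.toCompletion
  map_add' := α.toCompletion_add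
  map_smul' := α.toCompletion_smul

theorem denseRange_toCompletionₗ : DenseRange (α.toCompletionₗ (X := X) (E := E)) :=
  UniformSpace.Completion.denseRange_coe (α := (α.nrm X E).Space)

theorem functional_extension_iff (l : LipTensor 𝕜 X E →ₗ[𝕜] 𝕜) {P : Prop} (n : P → ℝ)
    (hn : ∀ h, 0 ≤ n h) :
    ((P ↔ ∃ Φ : StrongDual 𝕜 (α.Completion X E),
        ∀ w : LipTensor 𝕜 X E, Φ (α.toCompletion w) = l w) ∧
      ∀ (h : P) (Φ : StrongDual 𝕜 (α.Completion X E)),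
        (∀ w : LipTensor 𝕜 X E, Φ (α.toCompletion w) = l w) → n h = ‖Φ‖) ↔
    ∀ C : ℝ, 0 ≤ C → ((∃ h : P, n h ≤ C) ↔
      ∀ w : LipTensor 𝕜 X E, ‖l w‖ ≤ C * α.nrm X E w) := by
  have key := fun i : LipTensor 𝕜 X E →ₗ[𝕜] α.Completion X E =>
    strongDual_extension_iff (𝕜 := 𝕜) (W := LipTensor 𝕜 X E) (Z := α.Completion X E) i
  exact key α.toCompletionₗ α.denseRange_toCompletionₗ
    (fun w => α.nrm X E w) α.norm_toCompletion l n hn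

/-- The functional `w ↦ w(f)` extends to the completion, with norm `n`, if and only if it satisfies
exactly the bounds on `X ⊠ E` that are satisfied by `n`. -/
theorem extension_iff (f : LipDual 𝕜 X E) {P : Prop} (n : P → ℝ)
    (hn : ∀ h, 0 ≤ n h) :
    ((P ↔ ∃ Φ : StrongDual 𝕜 (α.Completion X E),
        ∀ w : LipTensor 𝕜 X E, Φ (α.toCompletion w) = w.1 f) ∧
      ∀ (h : P) (Φ : StrongDual 𝕜 (α.Completion X E)),
        (∀ w : LipTensor 𝕜 X E, Φ (α.toCompletion w) = w.1 f) → n h = ‖Φ‖) ↔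
    ∀ C : ℝ, 0 ≤ C → ((∃ h : P, n h ≤ C) ↔
      ∀ w : LipTensor 𝕜 X E, ‖w.1 f‖ ≤ C * α.nrm X E w) :=
  α.functional_extension_iff (evalₗ f) n hn

theorem nrm_tmap_le {Y : Type u} [MetricSpace Y] [Zero Y] {F : Type v} [NormedAddCommGroup F]
    [NormedSpace 𝕜 F] [CompleteSpace F] {h : PLip X Y} {T : E →L[𝕜] F} (hh : lipConst h.1 ≤ 1)
    (hT : ‖T‖ ≤ 1) (w : LipTensor 𝕜 X E) : α.nrm Y F (tmap h T w) ≤ α.nrm X E w := by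
  refine (α.metric_mapping X Y E F h T w).trans ?_
  refine mul_le_of_le_one_left (α.nrm_nonneg w) ?_
  exact mul_le_one₀ hh (norm_nonneg _) hT

end

variable {α} in
theorem IsFinitelyGenerated.le_mul_nrm (hα : α.IsFinitelyGenerated) {X : Type u} [MetricSpace X]
    [Zero X] {E : Type v} [NormedAddCommGroup E] [NormedSpace 𝕜 E] [CompleteSpace E]
    (w : LipTensor 𝕜 X E) {r C : ℝ} (hC : 0 ≤ C)
    (h : ∀ (X₀ : MFin X) (E₀ : FinDim 𝕜 E) (w₀ : LipTensor 𝕜 X₀.Pt E₀.sub),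
      tmap X₀.incl E₀.sub.subtypeL w₀ = w → r ≤ C * α.nrm X₀.Pt E₀.sub w₀) :
    r ≤ C * α.nrm X E w := by
  have hglb := hα X E w
  -- For C = 0 division is impossible. The claim is then r ≤ 0, and any one representation of w
  -- proves it.
  rcases hC.eq_or_lt with rfl | hC
  · obtain ⟨_, X₀, E₀, w₀, hw₀, -⟩ := hglb.nonempty
    simpa using h X₀ E₀ w₀ hw₀
  · rw [mul_comm, ← div_le_iff₀ hC]
    refine hglb.2 ?_
    rintro _ ⟨X₀, E₀, w₀, hw₀, rfl⟩
    rw [div_le_iff₀ hC, mul_comm]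
    exact h X₀ E₀ w₀ hw₀

end GenericCrossNorm

/-! ### Ideal norms and maximality through upper bounds. -/

namespace GenericIdeal

variable {𝕜 : Type} [RCLike 𝕜] (A : GenericIdeal.{u, v} 𝕜)

section

variable {X : Type u} [MetricSpace X] [Zero X] {E : Type v} [NormedAddCommGroup E]
  [NormedSpace 𝕜 E] [CompleteSpace E]

/-- `f` belongs to `A(X, E)` and `‖f‖_A ≤ C`. -/
def NormLE (f : Lip0 𝕜 X E) (C : ℝ) : Prop :=
  ∃ hf : f ∈ A.sub X E, A.nrm X E ⟨f, hf⟩ ≤ C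

theorem nrm_nonneg (f : A.sub X E) : 0 ≤ A.nrm X E f := apply_nonneg _ _

variable {A} in
theorem NormLE.nonneg {f : Lip0 𝕜 X E} {C : ℝ} (h : A.NormLE f C) : 0 ≤ C :=
  (A.nrm_nonneg _).trans h.2

theorem normLE_self (f : A.sub X E) : A.NormLE f.1 (A.nrm X E f) := ⟨f.2, le_refl _⟩

variable {A} in
theorem NormLE.comp {Z : Type u} [MetricSpace Z] [Zero Z] {F : Type v} [NormedAddCommGroup F]
    [NormedSpace 𝕜 F] [CompleteSpace F] {f : Lip0 𝕜 X E} {C : ℝ} (hf : A.NormLE f C)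
    (h : PLip Z X) (S : E →L[𝕜] F) : A.NormLE (comp S h f) (‖S‖ * C * lipConst h.1) := by
  obtain ⟨hm, hn⟩ := A.ideal Z X E F ⟨f, hf.1⟩ h S
  refine ⟨hm, hn.trans ?_⟩
  have := lipConst_nonneg h.1
  have := hf.2
  gcongr

variable {A} in
theorem NormLE.comp_of_le_one {Z : Type u} [MetricSpace Z] [Zero Z] {F : Type v}
    [NormedAddCommGroup F] [NormedSpace 𝕜 F] [CompleteSpace F] {f : Lip0 𝕜 X E} {C : ℝ}
    (hf : A.NormLE f C) {h : PLip Z X} {S : E →L[𝕜] F} (hh : lipConst h.1 ≤ 1) (hS : ‖S‖ ≤ 1) :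
    A.NormLE (LipschitzIdeals.comp S h f) C := by
  obtain ⟨hm, hn⟩ := hf.comp h S
  refine ⟨hm, hn.trans ?_⟩
  calc ‖S‖ * C * lipConst h.1 ≤ 1 * C * 1 := by
        have := hf.nonneg
        have := lipConst_nonneg h.1
        gcongr
    _ = C := by ring

theorem enorm_le_ofReal_iff {f : Lip0 𝕜 X E} {C : ℝ} (hC : 0 ≤ C) :
    A.enorm f ≤ ENNReal.ofReal C ↔ A.NormLE f C := by
  unfold enorm NormLE
  split_ifs with hf
  · rw [ENNReal.ofReal_le_ofReal_iff hC]
    exact ⟨fun h => ⟨hf, h⟩, fun h => h.2⟩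
  · simp [hf]

theorem maxNorm_le_ofReal_iff {f : Lip0 𝕜 X E} {C : ℝ} (hC : 0 ≤ C) :
    A.maxNorm f ≤ ENNReal.ofReal C ↔
      ∀ (Y : MFin X) (L : CoFin 𝕜 E), A.NormLE (comp L.proj Y.incl f) C := by
  simp only [maxNorm, iSup_le_iff, A.enorm_le_ofReal_iff hC]

variable {A} in
theorem NormLE.maxNorm_le {f : Lip0 𝕜 X E} {C : ℝ} (hf : A.NormLE f C) :
    A.maxNorm f ≤ ENNReal.ofReal C :=
  (A.maxNorm_le_ofReal_iff hf.nonneg).2 fun Y L =>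
    hf.comp_of_le_one Y.lipConst_incl_le (CoFin.norm_proj_le L)

theorem representedIn_iff (α : GenericCrossNorm.{u, v} 𝕜) :
    A.RepresentedIn α X E ↔ ∀ (f : Lip0 𝕜 X E) (C : ℝ), 0 ≤ C →
      (A.NormLE f C ↔ ∀ w : LipTensor 𝕜 X (StrongDual 𝕜 E),
        ‖w.1 (toBidual f)‖ ≤ C * α.nrm X (StrongDual 𝕜 E) w) :=
  forall_congr' fun f =>
    α.extension_iff (toBidual f) (fun hf : f ∈ A.sub X E => A.nrm X E ⟨f, hf⟩)
      fun _ => A.nrm_nonneg _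

end

/-- The ideal property always gives ‖f‖_{A^max} ≤ ‖f‖_A, since I_Y and Q_L are contractions. Only
the opposite implication has content. -/
theorem isMaximal_iff : A.IsMaximal ↔
    ∀ (X : Type u) [MetricSpace X] [Zero X] (E : Type v) [NormedAddCommGroup E]
      [NormedSpace 𝕜 E] [CompleteSpace E] (f : Lip0 𝕜 X E) (C : ℝ), 0 ≤ C →
      (∀ (Y : MFin X) (L : CoFin 𝕜 E), A.NormLE (comp L.proj Y.incl f) C) → A.NormLE f C := by
  constructor
  · intro h X _ _ E _ _ _ f C hC hf
    have hle := (A.maxNorm_le_ofReal_iff hC).2 hf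
    have hm := (h X E f).1.2 (hle.trans_lt ENNReal.ofReal_lt_top)
    refine ⟨hm, ?_⟩
    rw [(h X E f).2 hm]
    exact ENNReal.toReal_le_of_le_ofReal hC hle
  · intro h X _ _ E _ _ _ f
    have key : A.maxNorm f < ⊤ → A.NormLE f (A.maxNorm f).toReal := fun hlt =>
      h X E f _ ENNReal.toReal_nonneg ((A.maxNorm_le_ofReal_iff ENNReal.toReal_nonneg).1
        (ENNReal.ofReal_toReal hlt.ne).ge)
    have hlt : ∀ hf : f ∈ A.sub X E, A.maxNorm f < ⊤ := fun hf =>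
      (A.normLE_self ⟨f, hf⟩).maxNorm_le.trans_lt ENNReal.ofReal_lt_top
    exact ⟨⟨hlt, fun h => (key h).1⟩, fun hf => le_antisymm (key (hlt hf)).2
      (ENNReal.toReal_le_of_le_ofReal (A.nrm_nonneg _) (A.normLE_self ⟨f, hf⟩).maxNorm_le)⟩

end GenericIdeal


theorem norm_subtypeL_le {𝕜 E : Type*} [RCLike 𝕜] [NormedAddCommGroup E] [NormedSpace 𝕜 E]
    (M : Submodule 𝕜 E) : ‖M.subtypeL‖ ≤ 1 :=
  ContinuousLinearMap.opNorm_le_bound _ zero_le_one fun x => by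
    rw [one_mul]; exact le_refl _

/-! ### Finite-dimensional subspaces of E* acting on quotients of E. -/

section PreAnnihilator

variable {𝕜 : Type} [RCLike 𝕜] {E : Type v} [NormedAddCommGroup E] [NormedSpace 𝕜 E]

/-- The preannihilator of a finite-dimensional subspace of `E*`. -/
noncomputable def FinDim.preannihilator (M : FinDim 𝕜 (StrongDual 𝕜 E)) : CoFin 𝕜 E where
  sub := LinearMap.ker (M.sub.subtypeL.flip : E →L[𝕜] M.sub →L[𝕜] 𝕜).toLinearMap
  isClosed := (M.sub.subtypeL.flip : E →L[𝕜] M.sub →L[𝕜] 𝕜).isClosed_ker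
  finiteDimensional :=
    have := M.finiteDimensional
    (M.sub.subtypeL.flip : E →L[𝕜] M.sub →L[𝕜] 𝕜).toLinearMap.quotKerEquivRange.symm.finiteDimensional

theorem FinDim.apply_eq_zero (M : FinDim 𝕜 (StrongDual 𝕜 E)) (m : M.sub) {e : E}
    (he : e ∈ M.preannihilator.sub) : m.1 e = 0 :=
  DFunLike.congr_fun (LinearMap.mem_ker.1 he) m

/-- The functional on `E / L` induced by a functional on `E` that vanishes on `L`. -/
noncomputable def liftQuotient (L : Submodule 𝕜 E) [IsClosed (L : Set E)] (φ : StrongDual 𝕜 E)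
    (h : ∀ e ∈ L, φ e = 0) : StrongDual 𝕜 (E ⧸ L) :=
  (L.liftQ φ.toLinearMap h).mkContinuous ‖φ‖ fun q => by
    -- The quotient norm is an infimum, so representatives are only nearly optimal. The denominator
    -- ‖φ‖ + 1 covers φ = 0.
    refine le_of_forall_pos_le_add fun ε hε => ?_
    have hδ : 0 < ε / (‖φ‖ + 1) := by positivity
    obtain ⟨e, rfl, he⟩ := Submodule.Quotient.norm_mk_lt q hδ
    calc ‖φ e‖ ≤ ‖φ‖ * ‖e‖ := φ.le_opNorm e
      _ ≤ ‖φ‖ * (‖(Submodule.Quotient.mk e : E ⧸ L)‖ + ε / (‖φ‖ + 1)) := by gcongr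
      _ ≤ ‖φ‖ * ‖(Submodule.Quotient.mk e : E ⧸ L)‖ + ε := by
        rw [mul_add]
        gcongr
        rw [mul_div_assoc', div_le_iff₀ (by positivity)]
        nlinarith [norm_nonneg φ]

theorem norm_liftQuotient_le (L : Submodule 𝕜 E) [IsClosed (L : Set E)] (φ : StrongDual 𝕜 E)
    (h : ∀ e ∈ L, φ e = 0) : ‖liftQuotient L φ h‖ ≤ ‖φ‖ :=
  LinearMap.mkContinuous_norm_le _ (norm_nonneg _) _

/-- The canonical contraction `M → (E / M_⊥)*`. -/
noncomputable def FinDim.toDualQuotient (M : FinDim 𝕜 (StrongDual 𝕜 E)) :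
    M.sub →L[𝕜] StrongDual 𝕜 (E ⧸ M.preannihilator.sub) :=
  LinearMap.mkContinuous
    { toFun := fun m => liftQuotient _ m.1 fun _ he => M.apply_eq_zero m he
      map_add' := fun a b => by
        ext q
        obtain ⟨e, rfl⟩ := Submodule.Quotient.mk_surjective _ q
        rfl
      map_smul' := fun c a => by
        ext q
        obtain ⟨e, rfl⟩ := Submodule.Quotient.mk_surjective _ q
        rfl } 1 fun m => by
    rw [one_mul]
    exact norm_liftQuotient_le _ _ _

theorem FinDim.norm_toDualQuotient_le (M : FinDim 𝕜 (StrongDual 𝕜 E)) : ‖M.toDualQuotient‖ ≤ 1 :=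
  LinearMap.mkContinuous_norm_le _ zero_le_one _

end PreAnnihilator

section Transpose

variable {𝕜 : Type} [RCLike 𝕜] {X : Type*} [MetricSpace X] [Zero X]
  {D M : Type*} [NormedAddCommGroup D] [NormedSpace 𝕜 D] [NormedAddCommGroup M] [NormedSpace 𝕜 M]

/-- The restriction `D → M*` of the transpose of an operator `M → D*`. -/
noncomputable def transpose (S : M →L[𝕜] StrongDual 𝕜 D) : D →L[𝕜] StrongDual 𝕜 M :=
  ContinuousLinearMap.flip S

theorem norm_transpose_le (S : M →L[𝕜] StrongDual 𝕜 D) : ‖transpose S‖ ≤ ‖S‖ :=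
  (ContinuousLinearMap.opNorm_flip S).le

end Transpose

/-! ### Transferring bounds between X ⊠ E, X ⊠ E* and their finite pieces. -/

namespace GenericCrossNorm

variable {𝕜 : Type} [RCLike 𝕜] {α : GenericCrossNorm.{u, v} 𝕜}
  {X : Type u} [MetricSpace X] [Zero X] {D : Type v} [NormedAddCommGroup D]
  [NormedSpace 𝕜 D]

theorem IsFinitelyGenerated.norm_apply_le [CompleteSpace D] (hα : α.IsFinitelyGenerated)
    (f : LipDual 𝕜 X D) {C : ℝ}
    (hC : 0 ≤ C) (h : ∀ (X₀ : MFin X) (M : FinDim 𝕜 D) (w : LipTensor 𝕜 X₀.Pt M.sub),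
      ‖w.1 (comp (adj M.sub.subtypeL) X₀.incl f)‖ ≤ C * α.nrm X₀.Pt M.sub w)
    (w : LipTensor 𝕜 X D) : ‖w.1 f‖ ≤ C * α.nrm X D w :=
  hα.le_mul_nrm w hC fun X₀ M w₀ hw₀ => by
    rw [← hw₀]
    exact h X₀ M w₀

theorem IsFinitelyGenerated.norm_apply_toBidual_le (hα : α.IsFinitelyGenerated)
    (g : Lip0 𝕜 X D) {C : ℝ} (hC : 0 ≤ C)
    (h : ∀ (X₀ : MFin X) (M : FinDim 𝕜 (StrongDual 𝕜 D)) (w : LipTensor 𝕜 X₀.Pt M.sub),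
      ‖w.1 (comp (transpose M.sub.subtypeL) X₀.incl g)‖ ≤ C * α.nrm X₀.Pt M.sub w)
    (w : LipTensor 𝕜 X (StrongDual 𝕜 D)) :
    ‖w.1 (toBidual g)‖ ≤ C * α.nrm X (StrongDual 𝕜 D) w :=
  hα.norm_apply_le (toBidual g) hC h w

/-- The pairing of w with S^t g is the pairing of (id ⊠ S)w with κ_D g, and id ⊠ S does not increase
α. -/
theorem norm_apply_comp_transpose_le {M : Type v} [NormedAddCommGroup M] [NormedSpace 𝕜 M]
    [CompleteSpace M] (g : Lip0 𝕜 X D) {C : ℝ} (hC : 0 ≤ C)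
    (h : ∀ w : LipTensor 𝕜 X (StrongDual 𝕜 D),
      ‖w.1 (toBidual g)‖ ≤ C * α.nrm X (StrongDual 𝕜 D) w)
    {S : M →L[𝕜] StrongDual 𝕜 D} (hS : ‖S‖ ≤ 1) (w : LipTensor 𝕜 X M) :
    ‖w.1 (comp (transpose S) (PLip.id X) g)‖ ≤ C * α.nrm X M w :=
  (h (tmap (PLip.id X) S w)).trans
    (mul_le_mul_of_nonneg_left (α.nrm_tmap_le (lipConst_id_le X) hS w) hC)

/-- Bounds on `X ⊠ E` extend to `Y ⊠ M` for finite-dimensional `M ⊂ E**`. -/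
theorem norm_apply_comp_le [CompleteSpace D] {Y : Type u} [MetricSpace Y] [Zero Y] {M : Type v}
    [NormedAddCommGroup M] [NormedSpace 𝕜 M] [CompleteSpace M] [FiniteDimensional 𝕜 M]
    (f : LipDual 𝕜 X D) {C : ℝ} (hC : 0 ≤ C)
    (h : ∀ w : LipTensor 𝕜 X D, ‖w.1 f‖ ≤ C * α.nrm X D w) {k : PLip Y X} (hk : lipConst k.1 ≤ 1)
    {J : StrongDual 𝕜 D →L[𝕜] StrongDual 𝕜 M} (hJ : ‖J‖ ≤ 1) (w : LipTensor 𝕜 Y M) :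
    ‖w.1 (comp J k f)‖ ≤ C * α.nrm Y M w := by
  have hw := α.nrm_nonneg w
  have hN : 0 ≤ C * α.nrm Y M w := mul_nonneg hC hw
  have h1 : ∀ T : M →L[𝕜] D, ‖(tmap k T w).1 f‖ ≤ C * α.nrm Y M w * ‖T‖ := fun T => by
    refine (h (tmap k T w)).trans ?_
    have h2 := α.metric_mapping _ _ _ _ k T w
    calc C * α.nrm X D (tmap k T w) ≤ C * (1 * ‖T‖ * α.nrm Y M w) := by
          refine mul_le_mul_of_nonneg_left (h2.trans ?_) hC
          exact mul_le_mul_of_nonneg_right (mul_le_mul_of_nonneg_right hk (norm_nonneg _)) hw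
      _ = C * α.nrm Y M w * ‖T‖ := by ring
  have h3 := LipTensor.norm_apply_comp_le w (comp (ContinuousLinearMap.id 𝕜 _) k f) hN h1 J
  exact h3.trans (mul_le_of_le_one_right hN hJ)

end GenericCrossNorm

/-! ### Consequences of representation by a finitely generated cross-norm. -/

namespace GenericIdeal

variable {𝕜 : Type} [RCLike 𝕜] {A : GenericIdeal.{u, v} 𝕜}

/-- On X₀ ⊠ M the functional of f factors through that of Q f I_{X₀}, where Q maps onto E / M_⊥. It
suffices that M → (E / M_⊥)* is a contraction. -/
theorem isMaximal_of_representedIn {α : GenericCrossNorm.{u, v} 𝕜} (hα : α.IsFinitelyGenerated)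
    (hrep : ∀ (X : Type u) [MetricSpace X] [Zero X] (E : Type v) [NormedAddCommGroup E]
      [NormedSpace 𝕜 E] [CompleteSpace E], A.RepresentedIn α X E) : A.IsMaximal := by
  rw [isMaximal_iff]
  intro X _ _ E _ _ _ f C hC h
  refine ((A.representedIn_iff α).1 (hrep X E) f C hC).2 ?_
  refine hα.norm_apply_toBidual_le f hC fun X₀ M w₀ => ?_
  have h1 := ((A.representedIn_iff α).1 (hrep X₀.Pt (E ⧸ M.preannihilator.sub))
    (comp M.preannihilator.proj X₀.incl f) C hC).1 (h X₀ M.preannihilator)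
  exact GenericCrossNorm.norm_apply_comp_transpose_le _ hC h1 M.norm_toDualQuotient_le w₀

/-- Condition (1) for E* tests f against X ⊠ E**. The embedding of E in E** gives one direction.
Finite generation and local reflexivity give the other. -/
theorem normLE_iff_of_representedIn {α : GenericCrossNorm.{u, v} 𝕜} (hα : α.IsFinitelyGenerated)
    (hrep : ∀ (X : Type u) [MetricSpace X] [Zero X] (E : Type v) [NormedAddCommGroup E]
      [NormedSpace 𝕜 E] [CompleteSpace E], A.RepresentedIn α X E)
    {X : Type u} [MetricSpace X] [Zero X] {E : Type v} [NormedAddCommGroup E]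
    [NormedSpace 𝕜 E] [CompleteSpace E] (f : LipDual 𝕜 X E) {C : ℝ} (hC : 0 ≤ C) :
    A.NormLE f C ↔ ∀ w : LipTensor 𝕜 X E, ‖w.1 f‖ ≤ C * α.nrm X E w := by
  refine ((A.representedIn_iff α).1 (hrep X (StrongDual 𝕜 E)) f C hC).trans ?_
  constructor
  · intro h w
    have h1 := GenericCrossNorm.norm_apply_comp_transpose_le f hC h
      (S := NormedSpace.inclusionInDoubleDual 𝕜 E)
      (NormedSpace.inclusionInDoubleDual_norm_le 𝕜 E) w
    exact h1
  · intro h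
    refine hα.norm_apply_toBidual_le f hC fun X₀ M w => ?_
    have := M.finiteDimensional
    have hJ : ‖transpose M.sub.subtypeL‖ ≤ 1 := (norm_transpose_le _).trans (norm_subtypeL_le _)
    exact GenericCrossNorm.norm_apply_comp_le f hC h X₀.lipConst_incl_le hJ w

end GenericIdeal

namespace GenericIdeal

variable {𝕜 : Type} [RCLike 𝕜] {A : GenericIdeal.{u, v} 𝕜}

/-- Pairing of `A(X, E*)` with `X ⊠ E`. -/
noncomputable def pairing (A : GenericIdeal.{u, v} 𝕜) (X : Type u) [MetricSpace X] [Zero X]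
    (E : Type v) [NormedAddCommGroup E] [NormedSpace 𝕜 E] [CompleteSpace E] :
    A.Space X (StrongDual 𝕜 E) →ₗ[𝕜] LipTensor 𝕜 X E →ₗ[𝕜] 𝕜 where
  toFun b := evalₗ (A.toSpace.symm b).1
  map_add' _ _ := LinearMap.ext fun w => map_add w.1 _ _
  map_smul' c _ := LinearMap.ext fun w => map_smul w.1 c _

theorem pairing_injective (X : Type u) [MetricSpace X] [Zero X]
    (E : Type v) [NormedAddCommGroup E] [NormedSpace 𝕜 E] [CompleteSpace E] :
    Function.Injective (A.pairing X E) := by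
  intro a b hab
  obtain ⟨f, rfl⟩ := A.toSpace.surjective a
  obtain ⟨g, rfl⟩ := A.toSpace.surjective b
  congr 1
  refine Subtype.ext (Subtype.ext (funext fun x => ContinuousLinearMap.ext fun e => ?_))
  have h : (delta 𝕜 x 0 e).1 f.1 = (delta 𝕜 x 0 e).1 g.1 :=
    DFunLike.congr_fun hab (delta 𝕜 x 0 e)
  rw [delta_apply, delta_apply, f.1.2.1, g.1.2.1, sub_zero, sub_zero] at h
  exact h

theorem dualRepresented_of_representedIn {α : GenericCrossNorm.{u, v} 𝕜}
    (hα : α.IsFinitelyGenerated)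
    (hrep : ∀ (X : Type u) [MetricSpace X] [Zero X] (E : Type v) [NormedAddCommGroup E]
      [NormedSpace 𝕜 E] [CompleteSpace E], A.RepresentedIn α X E)
    (X : Type u) [MetricSpace X] [Zero X] (E : Type v) [NormedAddCommGroup E]
    [NormedSpace 𝕜 E] [CompleteSpace E] : A.DualRepresented α X E := by
  have hiff := fun (f : LipDual 𝕜 X E) (C : ℝ) (hC : 0 ≤ C) =>
    normLE_iff_of_representedIn hα hrep f hC
  have hle : ∀ (b : A.Space X (StrongDual 𝕜 E)) (w : LipTensor 𝕜 X E),
      ‖A.pairing X E b w‖ ≤ ‖b‖ * α.nrm X E w := fun b w => by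
    obtain ⟨f, rfl⟩ := A.toSpace.surjective b
    exact (hiff f.1 _ (A.nrm_nonneg f)).1 (A.normLE_self f) w
  have hsurj : ∀ (l : LipTensor 𝕜 X E →ₗ[𝕜] 𝕜) (C : ℝ), 0 ≤ C →
      (∀ w, ‖l w‖ ≤ C * α.nrm X E w) → ∃ b, ‖b‖ ≤ C ∧ A.pairing X E b = l := by
    intro l C hC hl
    -- The cross-norm identity turns the bound on l into a Lipschitz bound, so no functional is lost
    -- by restricting to Lipschitz maps.
    obtain ⟨f, hf⟩ := LipTensor.exists_lip_of_bound l hC fun x y e => by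
      rw [← α.cross X E x y e]
      exact hl _
    obtain ⟨hm, hn⟩ := (hiff f C hC).2 fun w => by
      rw [hf w]
      exact hl w
    exact ⟨A.toSpace ⟨f, hm⟩, hn, LinearMap.ext hf⟩
  have key := fun i : LipTensor 𝕜 X E →ₗ[𝕜] α.Completion X E =>
    exists_linearIsometryEquiv_strongDual (𝕜 := 𝕜) (W := LipTensor 𝕜 X E)
      (Z := α.Completion X E) (B := A.Space X (StrongDual 𝕜 E)) i
  obtain ⟨J, hJ⟩ := key α.toCompletionₗ α.denseRange_toCompletionₗ (fun w => α.nrm X E w)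
    α.norm_toCompletion (A.pairing X E) hle hsurj (A.pairing_injective X E)
  exact ⟨J, fun f w => hJ (A.toSpace f) w⟩

end GenericIdeal

/-! ### Lipschitz interpolation and separation by rank-one maps. -/

section Interpolation

variable {𝕜 : Type} [RCLike 𝕜] {X : Type*} [MetricSpace X] [Zero X]

theorem exists_lip_eq_one (𝕜 : Type) [RCLike 𝕜] {S : Set X} (hS : S.Finite) {s : X} (hs : s ≠ 0) :
    ∃ g : Lip0 𝕜 X 𝕜, g.1 s = 1 ∧ ∀ t ∈ S, t ≠ s → g.1 t = 0 := by
  -- The witness is dist(x, T) / dist(s, T). Putting 0 in T makes it preserve the base point.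
  set T : Set X := insert 0 (S \ {s}) with hT
  have hTf : T.Finite := (hS.subset Set.sdiff_subset).insert 0
  have hsT : s ∉ T := by simp [hT, hs]
  have hr : 0 < Metric.infDist s T :=
    (hTf.isClosed.notMem_iff_infDist_pos ⟨0, Set.mem_insert _ _⟩).1 hsT
  set r := Metric.infDist s T
  refine ⟨⟨fun x => ((Metric.infDist x T / r : ℝ) : 𝕜), ?_, (1 / r).toNNReal,
    LipschitzWith.of_dist_le_mul fun x y => ?_⟩, ?_, fun t ht hts => ?_⟩
  · simp [Metric.infDist_zero_of_mem (show (0 : X) ∈ T from Set.mem_insert _ _)]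
  · rw [dist_eq_norm, ← RCLike.ofReal_sub, RCLike.norm_ofReal, Real.coe_toNNReal _ (by positivity),
      ← sub_div, abs_div, abs_of_pos hr, div_mul_eq_mul_div, one_mul]
    gcongr
    have := (Metric.lipschitz_infDist_pt T).dist_le_mul x y
    simpa [Real.dist_eq] using this
  · change ((r / r : ℝ) : 𝕜) = 1
    rw [div_self hr.ne', RCLike.ofReal_one]
  · change ((Metric.infDist t T / r : ℝ) : 𝕜) = 0
    rw [Metric.infDist_zero_of_mem (show t ∈ T from Set.mem_insert_of_mem _ ⟨ht, hts⟩)]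
    simp

/-- Lipschitz functions that interpolate at finitely many points. -/
theorem exists_interpolation (𝕜 : Type) [RCLike 𝕜] (S : Finset X) :
    ∃ g : X → Lip0 𝕜 X 𝕜, ∀ {G : Type v} [NormedAddCommGroup G] [NormedSpace 𝕜 G]
      (f : Lip0 𝕜 X G), ∀ t ∈ S, (∑ s ∈ S, rankOne (g s) (f.1 s)).1 t = f.1 t := by
  classical
  have h : ∀ s : X, ∃ g : Lip0 𝕜 X 𝕜, s ≠ 0 → g.1 s = 1 ∧ ∀ t ∈ (S : Set X), t ≠ s → g.1 t = 0 :=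
    fun s => by
      by_cases hs : s = 0
      -- The function attached to the base point is irrelevant, because f(0) = 0 kills its term.
      · exact ⟨0, fun h => absurd hs h⟩
      · obtain ⟨g, hg⟩ := exists_lip_eq_one 𝕜 S.finite_toSet hs
        exact ⟨g, fun _ => hg⟩
  choose g hg using h
  refine ⟨g, fun {G} _ _ f t ht => ?_⟩
  have hsum : (∑ s ∈ S, rankOne (g s) (f.1 s)).1 t = ∑ s ∈ S, (g s).1 t • f.1 s := by
    simp [Finset.sum_apply]
  rw [hsum]
  by_cases ht0 : t = 0
  · rw [ht0, f.2.1]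
    exact Finset.sum_eq_zero fun s _ => by rw [(g s).2.1, zero_smul]
  · rw [Finset.sum_eq_single_of_mem t ht fun s _ hst => ?_, (hg t ht0).1, one_smul]
    by_cases hs0 : s = 0
    · rw [hs0, f.2.1, smul_zero]
    · rw [(hg s hs0).2 t ht (Ne.symm hst), zero_smul]

/-- An element of `X ⊠ E` that vanishes on rank-one maps is zero. -/
theorem LipTensor.eq_zero_of_rankOne {E : Type v} [NormedAddCommGroup E] [NormedSpace 𝕜 E]
    (w : LipTensor 𝕜 X E) (h : ∀ (g : Lip0 𝕜 X 𝕜) (φ : StrongDual 𝕜 E), w.1 (rankOne g φ) = 0) :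
    w = 0 := by
  classical
  refine Subtype.ext (LinearMap.ext fun f => ?_)
  obtain ⟨ι, _, x, y, e, rfl⟩ := LipTensor.exists_sum w
  set S : Finset X := Finset.univ.image x ∪ Finset.univ.image y with hS
  obtain ⟨g, hg⟩ := exists_interpolation.{v} 𝕜 S
  have hx : ∀ i, x i ∈ S := fun i => by simp [hS]
  have hy : ∀ i, y i ∈ S := fun i => by simp [hS]
  -- The tensor sees f only on the finite set S, where f agrees with a sum of rank-one maps.
  have h1 : (∑ i, delta 𝕜 (x i) (y i) (e i)).1 f =
      (∑ i, delta 𝕜 (x i) (y i) (e i)).1 (∑ s ∈ S, rankOne (g s) (f.1 s)) := by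
    rw [sum_delta_apply, sum_delta_apply]
    refine Finset.sum_congr rfl fun i _ => ?_
    rw [hg f _ (hx i), hg f _ (hy i)]
  rw [h1, map_sum]
  exact Finset.sum_eq_zero fun s _ => h _ _

theorem LipTensor.exists_bound {E : Type v} [NormedAddCommGroup E] [NormedSpace 𝕜 E]
    (w : LipTensor 𝕜 X E) : ∃ C : ℝ, 0 ≤ C ∧ ∀ f : LipDual 𝕜 X E, ‖w.1 f‖ ≤ C * lipConst f.1 := by
  obtain ⟨ι, _, x, y, e, rfl⟩ := LipTensor.exists_sum w
  refine ⟨∑ i, dist (x i) (y i) * ‖e i‖, by positivity, fun f => ?_⟩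
  rw [sum_delta_apply, Finset.sum_mul]
  refine norm_sum_le_of_le _ fun i _ => ?_
  have h := Lip0.dist_le f (x i) (y i)
  rw [dist_eq_norm] at h
  calc ‖(f.1 (x i) - f.1 (y i)) (e i)‖ ≤ ‖f.1 (x i) - f.1 (y i)‖ * ‖e i‖ :=
        ContinuousLinearMap.le_opNorm _ _
    _ ≤ lipConst f.1 * dist (x i) (y i) * ‖e i‖ := by gcongr
    _ = dist (x i) (y i) * ‖e i‖ * lipConst f.1 := by ring

end Interpolation

/-! ### The cross-norm dual to an ideal. -/

section DualNorm

variable {𝕜 : Type} [RCLike 𝕜] {W B : Type*} [AddCommGroup W] [Module 𝕜 W]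
  [NormedAddCommGroup B] [NormedSpace 𝕜 B]

/-- The norm on `W` dual to that of a normed space `B` of functionals on `W`. -/
noncomputable def dualVectorNorm (l : W →ₗ[𝕜] B →ₗ[𝕜] 𝕜)
    (hb : ∀ w, ∃ C : ℝ, ∀ b, ‖l w b‖ ≤ C * ‖b‖) (hl : ∀ w, (∀ b, l w b = 0) → w = 0) :
    VectorNorm 𝕜 W where
  toSeminorm := (normSeminorm 𝕜 (StrongDual 𝕜 B)).comp
    ({ toFun := fun w => (l w).mkContinuousOfExistsBound (hb w)
       map_add' := fun _ _ => by ext; simp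
       map_smul' := fun _ _ => by ext; simp } : W →ₗ[𝕜] StrongDual 𝕜 B)
  eq_zero_of_toFun w hw := hl w fun b => by
    have h : (l w).mkContinuousOfExistsBound (hb w) = 0 := norm_eq_zero.1 hw
    exact DFunLike.congr_fun h b

theorem dualVectorNorm_le (l : W →ₗ[𝕜] B →ₗ[𝕜] 𝕜)
    (hb : ∀ w, ∃ C : ℝ, ∀ b, ‖l w b‖ ≤ C * ‖b‖) (hl : ∀ w, (∀ b, l w b = 0) → w = 0) {w : W}
    {C : ℝ} (hC : 0 ≤ C) (h : ∀ b, ‖l w b‖ ≤ C * ‖b‖) : dualVectorNorm l hb hl w ≤ C :=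
  ContinuousLinearMap.opNorm_le_bound ((l w).mkContinuousOfExistsBound (hb w)) hC h

theorem le_dualVectorNorm (l : W →ₗ[𝕜] B →ₗ[𝕜] 𝕜)
    (hb : ∀ w, ∃ C : ℝ, ∀ b, ‖l w b‖ ≤ C * ‖b‖) (hl : ∀ w, (∀ b, l w b = 0) → w = 0) (w : W)
    (b : B) : ‖l w b‖ ≤ dualVectorNorm l hb hl w * ‖b‖ :=
  ((l w).mkContinuousOfExistsBound (hb w)).le_opNorm b

end DualNorm

namespace GenericIdeal

variable {𝕜 : Type} [RCLike 𝕜] (A : GenericIdeal.{u, v} 𝕜)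

section

variable {X : Type u} [MetricSpace X] [Zero X] {E : Type v} [NormedAddCommGroup E]
  [NormedSpace 𝕜 E] [CompleteSpace E]

theorem normLE_rankOne (g : Lip0 𝕜 X 𝕜) (e : E) :
    A.NormLE (rankOne g e) (lipConst g.1 * ‖e‖) := A.rankOne_le X E g e

variable {A} in
theorem NormLE.lipConst_le {f : Lip0 𝕜 X E} {C : ℝ} (h : A.NormLE f C) : lipConst f.1 ≤ C :=
  (A.lip_le X E ⟨f, h.1⟩).trans h.2

variable {A} in
theorem NormLE.mono {f : Lip0 𝕜 X E} {C C' : ℝ} (h : A.NormLE f C) (hC : C ≤ C') :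
    A.NormLE f C' := ⟨h.1, h.2.trans hC⟩

end

variable (X : Type u) [MetricSpace X] [Zero X] (E : Type v) [NormedAddCommGroup E]
  [NormedSpace 𝕜 E] [CompleteSpace E]

/-- Finiteness of the dual norm: w is bounded by a multiple of Lip, and Lip(f) ≤ ‖f‖_A. -/
theorem pairing_flip_bound (w : LipTensor 𝕜 X E) :
    ∃ C : ℝ, ∀ b, ‖(A.pairing X E).flip w b‖ ≤ C * ‖b‖ := by
  obtain ⟨C, hC, h⟩ := LipTensor.exists_bound w
  refine ⟨C, fun b => ?_⟩
  obtain ⟨f, rfl⟩ := A.toSpace.surjective b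
  refine (h f.1).trans ?_
  exact mul_le_mul_of_nonneg_left (A.lip_le X (StrongDual 𝕜 E) f) hC

/-- Definiteness of the dual norm: A contains the rank-one maps, and these separate tensors. -/
theorem eq_zero_of_pairing_flip (w : LipTensor 𝕜 X E)
    (h : ∀ b, (A.pairing X E).flip w b = 0) : w = 0 :=
  LipTensor.eq_zero_of_rankOne w fun g φ => by
    obtain ⟨hm, -⟩ := A.normLE_rankOne g φ
    exact h (A.toSpace ⟨rankOne g φ, hm⟩)

/-- The norm on `X ⊠ E` dual to that of `A(X, E*)`. -/
noncomputable def dualNorm : VectorNorm 𝕜 (LipTensor 𝕜 X E) :=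
  dualVectorNorm (B := A.Space X (StrongDual 𝕜 E)) (A.pairing X E).flip (A.pairing_flip_bound X E)
    (A.eq_zero_of_pairing_flip X E)

variable {X E}

theorem dualNorm_le {w : LipTensor 𝕜 X E} {C : ℝ} (hC : 0 ≤ C)
    (h : ∀ (f : LipDual 𝕜 X E) (r : ℝ), A.NormLE f r → ‖w.1 f‖ ≤ C * r) :
    A.dualNorm X E w ≤ C := by
  have hb : ∀ b : A.Space X (StrongDual 𝕜 E), ‖(A.pairing X E).flip w b‖ ≤ C * ‖b‖ := fun b => by
    obtain ⟨f, rfl⟩ := A.toSpace.surjective b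
    exact h f.1 _ (A.normLE_self f)
  have key := dualVectorNorm_le (B := A.Space X (StrongDual 𝕜 E)) (A.pairing X E).flip
    (A.pairing_flip_bound X E) (A.eq_zero_of_pairing_flip X E) (w := w) hC hb
  exact key

variable {A} in
theorem NormLE.norm_apply_le {f : LipDual 𝕜 X E} {C : ℝ} (hf : A.NormLE f C)
    (w : LipTensor 𝕜 X E) : ‖w.1 f‖ ≤ C * A.dualNorm X E w := by
  have h := le_dualVectorNorm (B := A.Space X (StrongDual 𝕜 E)) (A.pairing X E).flip
    (A.pairing_flip_bound X E) (A.eq_zero_of_pairing_flip X E) w (A.toSpace ⟨f, hf.1⟩)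
  rw [mul_comm]
  exact h.trans (mul_le_mul_of_nonneg_left hf.2 (apply_nonneg _ _))

theorem dualNorm_nonneg (w : LipTensor 𝕜 X E) : 0 ≤ A.dualNorm X E w := apply_nonneg _ _

/-- The upper bound is Lip(f) ≤ ‖f‖_A. The lower bound tests on g · φ, with g(z) = d(z, y) - d(0, y)
and φ norming e. -/
theorem dualNorm_delta (x y : X) (e : E) : A.dualNorm X E (delta 𝕜 x y e) = dist x y * ‖e‖ := by
  refine le_antisymm (A.dualNorm_le (by positivity) fun f r hf => ?_) ?_
  · have h := Lip0.dist_le f x y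
    rw [dist_eq_norm] at h
    rw [delta_apply]
    have hr := hf.lipConst_le
    calc ‖(f.1 x - f.1 y) e‖ ≤ ‖f.1 x - f.1 y‖ * ‖e‖ := ContinuousLinearMap.le_opNorm _ _
      _ ≤ lipConst f.1 * dist x y * ‖e‖ := by gcongr
      _ ≤ r * dist x y * ‖e‖ := by gcongr
      _ = dist x y * ‖e‖ * r := by ring
  · have hbound : ∀ z z' : X, dist (((dist z y - dist 0 y : ℝ) : 𝕜)) ((dist z' y - dist 0 y : ℝ) : 𝕜)
        ≤ 1 * dist z z' := fun z z' => by
      rw [dist_eq_norm, ← RCLike.ofReal_sub, RCLike.norm_ofReal, sub_sub_sub_cancel_right, one_mul]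
      exact abs_dist_sub_le z z' y
    let g : Lip0 𝕜 X 𝕜 := ⟨fun z => ((dist z y - dist 0 y : ℝ) : 𝕜), by simp, 1,
      LipschitzWith.of_dist_le_mul hbound⟩
    have hg : lipConst g.1 ≤ 1 := LipschitzIdeals.lipConst_le zero_le_one hbound
    obtain ⟨φ, hφ, hφe⟩ := exists_dual_vector'' 𝕜 e
    have h1 : A.NormLE (rankOne g φ) 1 :=
      (A.normLE_rankOne g φ).mono (mul_le_one₀ hg (norm_nonneg _) hφ)
    have h2 := h1.norm_apply_le (delta 𝕜 x y e)
    have h3 : (delta 𝕜 x y e).1 (rankOne g φ) = ((dist x y * ‖e‖ : ℝ) : 𝕜) := by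
      rw [delta_apply, rankOne_apply, rankOne_apply, ← sub_smul]
      change (((dist x y - dist 0 y : ℝ) : 𝕜) - ((dist y y - dist 0 y : ℝ) : 𝕜)) * φ e = _
      rw [hφe]
      push_cast
      simp
    rw [h3, RCLike.norm_ofReal, abs_of_nonneg (by positivity), one_mul] at h2
    exact h2

/-- The generic Lipschitz cross-norm dual to a generic Lipschitz operator Banach ideal. -/
noncomputable def dualCrossNorm : GenericCrossNorm.{u, v} 𝕜 where
  nrm X _ _ E _ _ _ := A.dualNorm X E
  cross X _ _ E _ _ _ x y e := A.dualNorm_delta x y e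
  dualizable X _ _ E _ _ _ g φ w := (A.normLE_rankOne g φ).norm_apply_le w
  metric_mapping X₀ X₁ _ _ _ _ E₀ E₁ _ _ _ _ _ _ h T w := by
    have hh := lipConst_nonneg h.1
    have hw := A.dualNorm_nonneg w
    refine A.dualNorm_le (by positivity) fun f r hf => ?_
    rw [tmap_apply]
    refine ((hf.comp h (adj T)).norm_apply_le w).trans ?_
    have hr := hf.nonneg
    calc ‖adj T‖ * r * lipConst h.1 * A.dualNorm X₀ E₀ w
        ≤ ‖T‖ * r * lipConst h.1 * A.dualNorm X₀ E₀ w := by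
          gcongr
          exact norm_adj_le T
      _ = lipConst h.1 * ‖T‖ * A.dualNorm X₀ E₀ w * r := by ring

end GenericIdeal

/-! ### Reflexivity of finite-dimensional spaces and perfect duality over finite sets. -/

section Bidual

variable {𝕜 : Type} [RCLike 𝕜]

/-- A pairing with the dual of a finite-dimensional space `G` is induced by a map into `G`. -/
theorem exists_clm_of_pairing (G : Type*) [NormedAddCommGroup G] [NormedSpace 𝕜 G]
    [FiniteDimensional 𝕜 G] {B : Type*} [NormedAddCommGroup B] [NormedSpace 𝕜 B]
    (P : StrongDual 𝕜 G →L[𝕜] StrongDual 𝕜 B) (hP : ‖P‖ ≤ 1) : ∃ R : B →L[𝕜] G,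
      (∀ Φ, ‖R Φ‖ ≤ ‖Φ‖) ∧ ∀ (Φ : B) (φ : StrongDual 𝕜 G), φ (R Φ) = P φ Φ := by
  let b := Module.finBasis 𝕜 G
  let b' : Fin (Module.finrank 𝕜 G) → StrongDual 𝕜 G := fun j => (b.coord j).toContinuousLinearMap
  let R : B →L[𝕜] G := ∑ j, (P (b' j)).smulRight (b j)
  have hφ : ∀ φ : StrongDual 𝕜 G, ∑ j, φ (b j) • b' j = φ := fun φ => by
    ext x
    rw [sum_apply]
    conv_rhs => rw [← b.sum_repr x, map_sum]
    refine Finset.sum_congr rfl fun j _ => ?_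
    rw [map_smul, smul_eq_mul, mul_comm]
    rfl
  have hR : ∀ (Φ : B) (φ : StrongDual 𝕜 G), φ (R Φ) = P φ Φ := fun Φ φ => by
    conv_rhs => rw [← hφ φ, map_sum, sum_apply]
    rw [sum_apply, map_sum]
    refine Finset.sum_congr rfl fun j _ => ?_
    rw [ContinuousLinearMap.smulRight_apply, map_smul, map_smul, smul_apply, smul_eq_mul,
      smul_eq_mul, mul_comm]
  refine ⟨R, fun Φ => NormedSpace.norm_le_dual_bound 𝕜 _ (norm_nonneg _) fun φ => ?_, hR⟩
  rw [hR, mul_comm]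
  exact ((P φ).le_opNorm Φ).trans (mul_le_mul_of_nonneg_right
    ((P.le_opNorm φ).trans (mul_le_of_le_one_left (norm_nonneg _) hP)) (norm_nonneg _))

theorem exists_clm_of_embedding (G : Type*) [NormedAddCommGroup G] [NormedSpace 𝕜 G]
    [FiniteDimensional 𝕜 G] {D : Type*} [NormedAddCommGroup D] [NormedSpace 𝕜 D]
    (e : StrongDual 𝕜 G →L[𝕜] D) (he : ‖e‖ ≤ 1) : ∃ R : StrongDual 𝕜 D →L[𝕜] G,
      (∀ Φ, ‖R Φ‖ ≤ ‖Φ‖) ∧ ∀ (Φ : StrongDual 𝕜 D) (φ : StrongDual 𝕜 G), φ (R Φ) = Φ (e φ) :=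
  exists_clm_of_pairing G ((NormedSpace.inclusionInDoubleDual 𝕜 D).comp e)
    ((ContinuousLinearMap.opNorm_comp_le _ e).trans
      (mul_le_one₀ (NormedSpace.inclusionInDoubleDual_norm_le 𝕜 D) (norm_nonneg _) he))

/-- Finite-dimensional spaces are reflexive. -/
theorem exists_bidual_inverse (G : Type*) [NormedAddCommGroup G] [NormedSpace 𝕜 G]
    [FiniteDimensional 𝕜 G] : ∃ R : StrongDual 𝕜 (StrongDual 𝕜 G) →L[𝕜] G,
      (∀ Φ, ‖R Φ‖ ≤ ‖Φ‖) ∧ ∀ (Φ : StrongDual 𝕜 (StrongDual 𝕜 G)) (φ : StrongDual 𝕜 G),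
        φ (R Φ) = Φ φ :=
  exists_clm_of_embedding G (ContinuousLinearMap.id 𝕜 (StrongDual 𝕜 G))
    ContinuousLinearMap.norm_id_le

end Bidual

section RankOne

variable {𝕜 : Type} [RCLike 𝕜] {X : Type*} [MetricSpace X] [Zero X] {E : Type*}
  [NormedAddCommGroup E] [NormedSpace 𝕜 E]

theorem rankOne_add (g : Lip0 𝕜 X 𝕜) (a b : E) :
    rankOne g (a + b) = rankOne g a + rankOne g b :=
  Subtype.ext (funext fun _ => smul_add _ _ _)

theorem rankOne_smul (g : Lip0 𝕜 X 𝕜) (c : 𝕜) (a : E) : rankOne g (c • a) = c • rankOne g a :=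
  Subtype.ext (funext fun _ => smul_comm _ _ _)

end RankOne

namespace GenericIdeal

variable {𝕜 : Type} [RCLike 𝕜] (A : GenericIdeal.{u, v} 𝕜)

section Finite

variable {Y : Type u} [MetricSpace Y] [Zero Y] [Finite Y] {G : Type v} [NormedAddCommGroup G]
  [NormedSpace 𝕜 G] [CompleteSpace G]

omit [Finite Y] in
/-- The map `e ↦ g · e` into `A(Y, G)`. -/
noncomputable def rankOneₗ (g : Lip0 𝕜 Y 𝕜) (G : Type v) [NormedAddCommGroup G]
    [NormedSpace 𝕜 G] [CompleteSpace G] : G →ₗ[𝕜] A.Space Y G where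
  toFun e := A.toSpace ⟨rankOne g e, (A.normLE_rankOne g e).1⟩
  map_add' a b := by
    rw [← map_add]
    exact congrArg A.toSpace (Subtype.ext (rankOne_add g a b))
  map_smul' c a := by
    rw [← map_smul]
    exact congrArg A.toSpace (Subtype.ext (rankOne_smul g c a))

omit [Finite Y] in
theorem norm_rankOneₗ_le (g : Lip0 𝕜 Y 𝕜) (e : G) : ‖A.rankOneₗ g G e‖ ≤ lipConst g.1 * ‖e‖ :=
  (A.normLE_rankOne g e).2

/-- Functionals on `A(Y, G)`, for `Y` finite, come from `Y ⊠ G*`. -/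
theorem exists_tensor_eq (Y : Type u) [MetricSpace Y] [Zero Y] [Finite Y] (G : Type v)
    [NormedAddCommGroup G] [NormedSpace 𝕜 G] [CompleteSpace G] (ψ : StrongDual 𝕜 (A.Space Y G)) :
    ∃ u : LipTensor 𝕜 Y (StrongDual 𝕜 G), ∀ f : Lip0 𝕜 Y G,
      ∃ hf : f ∈ A.sub Y G, u.1 (toBidual f) = ψ (A.toSpace ⟨f, hf⟩) := by
  have := Fintype.ofFinite Y
  obtain ⟨g, hg⟩ := exists_interpolation.{v} 𝕜 (Finset.univ : Finset Y)
  -- On a finite set f = ∑ g_s · f(s), so ψ is determined by the functionals b ↦ ψ(g_s · b).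
  let e : Y → StrongDual 𝕜 G := fun s =>
    (ψ.toLinearMap.comp (A.rankOneₗ (g s) G)).mkContinuous (‖ψ‖ * lipConst (g s).1) fun b => by
      rw [mul_assoc]
      exact (ψ.le_opNorm _).trans
        (mul_le_mul_of_nonneg_left (A.norm_rankOneₗ_le (g s) b) (norm_nonneg _))
  refine ⟨∑ s, delta 𝕜 s 0 (e s), fun f => ?_⟩
  have hsum : ∑ s, rankOne (g s) (f.1 s) = f :=
    Subtype.ext (funext fun t => hg f t (Finset.mem_univ t))
  have hf : f ∈ A.sub Y G := by
    rw [← hsum]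
    exact Submodule.sum_mem _ fun s _ => (A.normLE_rankOne (g s) (f.1 s)).1
  refine ⟨hf, ?_⟩
  have h1 : A.toSpace ⟨f, hf⟩ = ∑ s, A.rankOneₗ (g s) G (f.1 s) := by
    have h2 : (⟨f, hf⟩ : A.sub Y G) =
        ∑ s, ⟨rankOne (g s) (f.1 s), (A.normLE_rankOne (g s) (f.1 s)).1⟩ :=
      Subtype.ext (by rw [Submodule.coe_sum]; exact hsum.symm)
    rw [h2, map_sum]
    rfl
  rw [sum_delta_apply, h1, map_sum]
  refine Finset.sum_congr rfl fun s _ => ?_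
  rw [(toBidual f).2.1, sub_zero]
  rfl

/-- For `Y` finite and `G` finite-dimensional, the norm of `A(Y, G)` is dual to that of
`Y ⊠ G*`. -/
theorem normLE_of_finite [FiniteDimensional 𝕜 G] (f : Lip0 𝕜 Y G) {C : ℝ}
    (h : ∀ w : LipTensor 𝕜 Y (StrongDual 𝕜 G),
      ‖w.1 (toBidual f)‖ ≤ C * A.dualNorm Y (StrongDual 𝕜 G) w) (hC : 0 ≤ C) : A.NormLE f C := by
  -- The zero functional is used only to learn that every Lipschitz map on the finite set Y lies in
  -- A.
  obtain ⟨_, h0⟩ := A.exists_tensor_eq Y G 0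
  obtain ⟨hf, -⟩ := h0 f
  refine ⟨hf, ?_⟩
  obtain ⟨ψ, hψ, hψf⟩ := exists_dual_vector'' 𝕜 (A.toSpace ⟨f, hf⟩)
  obtain ⟨w, hw⟩ := A.exists_tensor_eq Y G ψ
  obtain ⟨R, hRn, hR⟩ := exists_bidual_inverse (𝕜 := 𝕜) G
  -- The dual norm tests w on maps F into G**. Each is κ_G composed with R F, and R is a
  -- contraction, so w(F) = ψ(R F) is controlled by ‖ψ‖ ≤ 1.
  have h1 : A.dualNorm Y (StrongDual 𝕜 G) w ≤ 1 := by
    refine A.dualNorm_le zero_le_one fun F r hF => ?_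
    have hF' : A.NormLE (comp R (PLip.id Y) F) r :=
      hF.comp_of_le_one (lipConst_id_le Y)
        (ContinuousLinearMap.opNorm_le_bound _ zero_le_one fun Φ => by
          rw [one_mul]; exact hRn Φ)
    have hFb : toBidual (comp R (PLip.id Y) F) = F :=
      Subtype.ext (funext fun y => ContinuousLinearMap.ext fun φ => hR _ φ)
    obtain ⟨hm, he⟩ := hw (comp R (PLip.id Y) F)
    rw [hFb] at he
    rw [he, one_mul]
    refine (ψ.le_opNorm _).trans ?_
    exact (mul_le_of_le_one_left (norm_nonneg _) hψ).trans hF'.2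
  obtain ⟨hm, he⟩ := hw f
  have h2 : ‖w.1 (toBidual f)‖ = A.nrm Y G ⟨f, hf⟩ := by
    rw [he, hψf, RCLike.norm_ofReal, abs_norm]
    rfl
  rw [← h2]
  exact (h w).trans (mul_le_of_le_one_right hC h1)

end Finite

theorem normLE_toBidual {X : Type u} [MetricSpace X] [Zero X] {E : Type v} [NormedAddCommGroup E]
    [NormedSpace 𝕜 E] [CompleteSpace E] {f : Lip0 𝕜 X E} {C : ℝ} (hf : A.NormLE f C) :
    A.NormLE (toBidual f) C :=
  hf.comp_of_le_one (lipConst_id_le X) (NormedSpace.inclusionInDoubleDual_norm_le 𝕜 E)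

theorem norm_apply_toBidual_comp_le {α : GenericCrossNorm.{u, v} 𝕜} {X Y : Type u} [MetricSpace X]
    [Zero X] [MetricSpace Y] [Zero Y] {E G : Type v} [NormedAddCommGroup E]
    [NormedSpace 𝕜 E] [NormedAddCommGroup G] [NormedSpace 𝕜 G]
    (f : Lip0 𝕜 X E) {C : ℝ} (hC : 0 ≤ C)
    (h : ∀ w : LipTensor 𝕜 X (StrongDual 𝕜 E),
      ‖w.1 (toBidual f)‖ ≤ C * α.nrm X (StrongDual 𝕜 E) w) {k : PLip Y X} (hk : lipConst k.1 ≤ 1)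
    {T : E →L[𝕜] G} (hT : ‖T‖ ≤ 1) (w : LipTensor 𝕜 Y (StrongDual 𝕜 G)) :
    ‖w.1 (toBidual (comp T k f))‖ ≤ C * α.nrm Y (StrongDual 𝕜 G) w :=
  (h (tmap k (adj T) w)).trans (mul_le_mul_of_nonneg_left
    (α.nrm_tmap_le hk ((norm_adj_le T).trans hT) w) hC)

/-- Composing with κ_E gives the easy half. For the converse, a bound for f passes to every Q_L f
I_Y through the adjoint of Q_L, finite duality bounds its A-norm, and maximality returns to f. -/
theorem IsMaximal.representedIn {A : GenericIdeal.{u, v} 𝕜} (hA : A.IsMaximal) (X : Type u)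
    [MetricSpace X] [Zero X] (E : Type v) [NormedAddCommGroup E] [NormedSpace 𝕜 E]
    [CompleteSpace E] : A.RepresentedIn A.dualCrossNorm X E := by
  refine (A.representedIn_iff A.dualCrossNorm).2 fun f C hC => ⟨fun hf => ?_, fun h => ?_⟩
  · exact (A.normLE_toBidual hf).norm_apply_le
  · refine A.isMaximal_iff.1 hA X E f C hC fun Y L => ?_
    have := L.finiteDimensional
    exact A.normLE_of_finite _ (norm_apply_toBidual_comp_le f hC h Y.lipConst_incl_le
      (CoFin.norm_proj_le L)) hC

end GenericIdeal

theorem le_mul_csInf {S : Set ℝ} (hS : S.Nonempty) {r C : ℝ} (hC : 0 ≤ C)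
    (h : ∀ s ∈ S, r ≤ C * s) : r ≤ C * sInf S := by
  rcases hC.eq_or_lt with rfl | hC
  · obtain ⟨s, hs⟩ := hS
    simpa using h s hs
  · rw [mul_comm, ← div_le_iff₀ hC]
    refine le_csInf hS fun s hs => ?_
    rw [div_le_iff₀ hC, mul_comm]
    exact h s hs

section Tensor

variable {𝕜 : Type} [RCLike 𝕜] {X Y : Type*} [MetricSpace X] [Zero X] [MetricSpace Y] [Zero Y]
  {E F : Type*} [NormedAddCommGroup E] [NormedSpace 𝕜 E] [NormedAddCommGroup F] [NormedSpace 𝕜 F]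

theorem tmap_add (h : PLip X Y) (T : E →L[𝕜] F) (w z : LipTensor 𝕜 X E) :
    tmap h T (w + z) = tmap h T w + tmap h T z := map_add _ _ _

theorem tmap_smul (h : PLip X Y) (T : E →L[𝕜] F) (c : 𝕜) (w : LipTensor 𝕜 X E) :
    tmap h T (c • w) = c • tmap h T w := map_smul _ _ _

end Tensor

/-! ### The finite hull of a cross-norm. -/

/-- The union of two finite pointed subsets. -/
def MFin.union {X : Type u} [Zero X] (Y Z : MFin X) : MFin X :=
  ⟨Y.set ∪ Z.set, Y.finite.union Z.finite, Or.inl Y.zero_mem⟩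

section FinDim

variable {𝕜 : Type} [RCLike 𝕜] {E : Type v} [NormedAddCommGroup E] [NormedSpace 𝕜 E]

/-- The sum of two finite-dimensional subspaces. -/
def FinDim.sum (M N : FinDim 𝕜 E) : FinDim 𝕜 E :=
  ⟨M.sub ⊔ N.sub, by
    have := M.finiteDimensional
    have := N.finiteDimensional
    infer_instance⟩

/-- The inclusion between subspaces. -/
noncomputable def submoduleIncl {M N : Submodule 𝕜 E} (h : M ≤ N) : M →L[𝕜] N :=
  (Submodule.inclusion h).mkContinuous 1 fun x => by rw [one_mul]; exact le_refl _

theorem norm_submoduleIncl_le {M N : Submodule 𝕜 E} (h : M ≤ N) : ‖submoduleIncl h‖ ≤ 1 :=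
  LinearMap.mkContinuous_norm_le _ zero_le_one _

end FinDim

namespace GenericCrossNorm

variable {𝕜 : Type} [RCLike 𝕜] (α : GenericCrossNorm.{u, v} 𝕜)

section Hull

variable {X : Type u} [MetricSpace X] [Zero X] {E : Type v} [NormedAddCommGroup E]
  [NormedSpace 𝕜 E]

theorem _root_.LipschitzIdeals.LipTensor.exists_finite (w : LipTensor 𝕜 X E) :
    ∃ (X₀ : MFin X) (E₀ : FinDim 𝕜 E) (w₀ : LipTensor 𝕜 X₀.Pt E₀.sub),
      tmap X₀.incl E₀.sub.subtypeL w₀ = w := by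
  obtain ⟨ι, _, x, y, e, rfl⟩ := LipTensor.exists_sum w
  let X₀ : MFin X := ⟨insert 0 (Set.range x ∪ Set.range y),
    ((Set.finite_range x).union (Set.finite_range y)).insert 0, Or.inl rfl⟩
  let E₀ : FinDim 𝕜 E := ⟨Submodule.span 𝕜 (Set.range e),
    FiniteDimensional.span_of_finite 𝕜 (Set.finite_range e)⟩
  let x₀ : ι → X₀.Pt := fun i => ⟨x i, Or.inr (Or.inl ⟨i, rfl⟩)⟩
  let y₀ : ι → X₀.Pt := fun i => ⟨y i, Or.inr (Or.inr ⟨i, rfl⟩)⟩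
  let e₀ : ι → E₀.sub := fun i => ⟨e i, Submodule.subset_span ⟨i, rfl⟩⟩
  refine ⟨X₀, E₀, ∑ i, delta 𝕜 (x₀ i) (y₀ i) (e₀ i), ?_⟩
  rw [map_sum]
  exact Finset.sum_congr rfl fun i _ => tmap_delta _ _ _ _ _

/-- The finite hull of `α`: the infimum of `α(w; X₀, E₀)` over `X₀ ∈ MFIN(X)` and `E₀ ∈ FIN(E)`
with `w ∈ X₀ ⊠ E₀`. -/
noncomputable def finHull (w : LipTensor 𝕜 X E) : ℝ :=
  sInf {r : ℝ | ∃ (X₀ : MFin X) (E₀ : FinDim 𝕜 E) (w₀ : LipTensor 𝕜 X₀.Pt E₀.sub),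
      tmap X₀.incl E₀.sub.subtypeL w₀ = w ∧ α.nrm X₀.Pt E₀.sub w₀ = r}

theorem le_mul_finHull {w : LipTensor 𝕜 X E} {r C : ℝ} (hC : 0 ≤ C)
    (h : ∀ (X₀ : MFin X) (E₀ : FinDim 𝕜 E) (w₀ : LipTensor 𝕜 X₀.Pt E₀.sub),
      tmap X₀.incl E₀.sub.subtypeL w₀ = w → r ≤ C * α.nrm X₀.Pt E₀.sub w₀) :
    r ≤ C * α.finHull w := by
  obtain ⟨X₀, E₀, w₀, hw₀⟩ := LipTensor.exists_finite w
  refine le_mul_csInf ?_ hC ?_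
  · exact ⟨_, X₀, E₀, w₀, hw₀, rfl⟩
  rintro _ ⟨X₀, E₀, w₀, hw₀, rfl⟩
  exact h X₀ E₀ w₀ hw₀

theorem le_finHull {w : LipTensor 𝕜 X E} {r : ℝ}
    (h : ∀ (X₀ : MFin X) (E₀ : FinDim 𝕜 E) (w₀ : LipTensor 𝕜 X₀.Pt E₀.sub),
      tmap X₀.incl E₀.sub.subtypeL w₀ = w → r ≤ α.nrm X₀.Pt E₀.sub w₀) : r ≤ α.finHull w :=
  (α.le_mul_finHull zero_le_one fun X₀ E₀ w₀ hw₀ =>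
    (h X₀ E₀ w₀ hw₀).trans_eq (one_mul _).symm).trans_eq (one_mul _)

theorem finHull_le {w : LipTensor 𝕜 X E} (X₀ : MFin X) (E₀ : FinDim 𝕜 E)
    {w₀ : LipTensor 𝕜 X₀.Pt E₀.sub} (hw₀ : tmap X₀.incl E₀.sub.subtypeL w₀ = w) :
    α.finHull w ≤ α.nrm X₀.Pt E₀.sub w₀ := by
  refine csInf_le ⟨0, ?_⟩ ⟨X₀, E₀, w₀, hw₀, rfl⟩
  rintro _ ⟨X₁, E₁, w₁, -, rfl⟩
  exact α.nrm_nonneg w₁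

theorem le_finHull_self [CompleteSpace E] (w : LipTensor 𝕜 X E) : α.nrm X E w ≤ α.finHull w :=
  α.le_finHull fun X₀ E₀ w₀ hw₀ => by
    rw [← hw₀]
    exact α.nrm_tmap_le X₀.lipConst_incl_le (norm_subtypeL_le _) w₀

theorem finHull_nonneg (w : LipTensor 𝕜 X E) : 0 ≤ α.finHull w :=
  α.le_finHull fun _ _ w₀ _ => α.nrm_nonneg w₀

theorem nrm_add_le [CompleteSpace E] (w z : LipTensor 𝕜 X E) :
    α.nrm X E (w + z) ≤ α.nrm X E w + α.nrm X E z :=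
  map_add_le_add (α.nrm X E).toSeminorm w z

theorem nrm_smul [CompleteSpace E] (c : 𝕜) (w : LipTensor 𝕜 X E) :
    α.nrm X E (c • w) = ‖c‖ * α.nrm X E w :=
  map_smul_eq_mul (α.nrm X E).toSeminorm c w

theorem finHull_add_le_of_le {w z : LipTensor 𝕜 X E} {X₀ X₁ X₂ : MFin X} {E₀ E₁ E₂ : FinDim 𝕜 E}
    (hX₀ : X₀.set ⊆ X₂.set) (hX₁ : X₁.set ⊆ X₂.set) (hE₀ : E₀.sub ≤ E₂.sub)
    (hE₁ : E₁.sub ≤ E₂.sub) {w₀ : LipTensor 𝕜 X₀.Pt E₀.sub}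
    (hw : tmap X₀.incl E₀.sub.subtypeL w₀ = w) {z₀ : LipTensor 𝕜 X₁.Pt E₁.sub}
    (hz : tmap X₁.incl E₁.sub.subtypeL z₀ = z) :
    α.finHull (w + z) ≤ α.nrm X₀.Pt E₀.sub w₀ + α.nrm X₁.Pt E₁.sub z₀ := by
  have h0 := α.nrm_tmap_le (MFin.lipConst_inclOfLE_le hX₀) (norm_submoduleIncl_le hE₀) w₀
  have h1 := α.nrm_tmap_le (MFin.lipConst_inclOfLE_le hX₁) (norm_submoduleIncl_le hE₁) z₀
  refine (α.finHull_le X₂ E₂ ((tmap_add _ _ (tmap (MFin.inclOfLE hX₀) (submoduleIncl hE₀) w₀)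
    (tmap (MFin.inclOfLE hX₁) (submoduleIncl hE₁) z₀)).trans (congrArg₂ (· + ·) hw hz))).trans ?_
  exact (α.nrm_add_le _ _).trans (add_le_add h0 h1)

theorem finHull_add_le (w z : LipTensor 𝕜 X E) :
    α.finHull (w + z) ≤ α.finHull w + α.finHull z :=
  -- The two infima are removed one at a time. Any two representations then meet in the union of the
  -- point sets and the sum of the subspaces.
  sub_le_iff_le_add'.1 <| α.le_finHull fun X₁ E₁ _ hz =>
    sub_le_comm.1 <| α.le_finHull fun X₀ E₀ _ hw => sub_le_iff_le_add.2 <|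
      α.finHull_add_le_of_le (X₂ := X₀.union X₁) (E₂ := E₀.sum E₁) Set.subset_union_left
        Set.subset_union_right le_sup_left le_sup_right hw hz

theorem finHull_smul_le (c : 𝕜) (w : LipTensor 𝕜 X E) : α.finHull (c • w) ≤ ‖c‖ * α.finHull w :=
  α.le_mul_finHull (norm_nonneg c) fun X₀ E₀ w₀ hw =>
    (α.finHull_le X₀ E₀ ((tmap_smul _ _ c w₀).trans (congrArg (c • ·) hw))).trans_eq
      (α.nrm_smul c w₀)

theorem finHull_zero : α.finHull (0 : LipTensor 𝕜 X E) = 0 := by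
  refine le_antisymm ?_ (α.finHull_nonneg _)
  have h := α.finHull_smul_le 0 (0 : LipTensor 𝕜 X E)
  rwa [zero_smul, norm_zero, zero_mul] at h

/-- The finite hull of `α`, as a norm. -/
noncomputable def finHullNorm (X : Type u) [MetricSpace X] [Zero X] (E : Type v)
    [NormedAddCommGroup E] [NormedSpace 𝕜 E] [CompleteSpace E] :
    VectorNorm 𝕜 (LipTensor 𝕜 X E) where
  toSeminorm := Seminorm.ofSMulLE α.finHull α.finHull_zero α.finHull_add_le α.finHull_smul_le
  eq_zero_of_toFun w hw :=
    (α.nrm X E).eq_zero_of_toFun w (le_antisymm ((α.le_finHull_self w).trans_eq hw) (α.nrm_nonneg w))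

theorem nrm_tmap_id_le [CompleteSpace E] {M : Type v} [NormedAddCommGroup M] [NormedSpace 𝕜 M]
    [CompleteSpace M] (S : M →L[𝕜] E) {r : ℝ} (hS : ‖S‖ ≤ r) (w : LipTensor 𝕜 X M) :
    α.nrm X E (tmap (PLip.id X) S w) ≤ α.nrm X M w * r := by
  refine (α.metric_mapping _ _ _ _ (PLip.id X) S w).trans ?_
  rw [mul_comm (α.nrm X M w)]
  refine mul_le_mul_of_nonneg_right ?_ (α.nrm_nonneg w)
  exact (mul_le_of_le_one_left (norm_nonneg _) (lipConst_id_le X)).trans hS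

theorem finHull_tmap_le_of_factor (X₀ : MFin X) (E₀ : FinDim 𝕜 E) {M : Type v}
    [NormedAddCommGroup M] [NormedSpace 𝕜 M] [CompleteSpace M] (T : M →L[𝕜] E)
    (S : M →L[𝕜] E₀.sub) (hS : ‖S‖ ≤ ‖T‖) (hST : E₀.sub.subtypeL.comp S = T)
    (w : LipTensor 𝕜 X₀.Pt M) : α.finHull (tmap X₀.incl T w) ≤ α.nrm X₀.Pt M w * ‖T‖ :=
  (α.finHull_le X₀ E₀ ((tmap_tmap (PLip.id X₀.Pt) X₀.incl S E₀.sub.subtypeL w).trans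
    (congrArg (fun T => tmap X₀.incl T w) hST))).trans (α.nrm_tmap_id_le S hS w)

/-- T factors through its finite-dimensional range without increase of norm, so its image tensor
already lives on an admissible finite piece. -/
theorem finHull_tmap_le (X₀ : MFin X) {M : Type v} [NormedAddCommGroup M] [NormedSpace 𝕜 M]
    [CompleteSpace M] [FiniteDimensional 𝕜 M] (T : M →L[𝕜] E) (w : LipTensor 𝕜 X₀.Pt M) :
    α.finHull (tmap X₀.incl T w) ≤ α.nrm X₀.Pt M w * ‖T‖ :=
  α.finHull_tmap_le_of_factor X₀ ⟨LinearMap.range T.toLinearMap, inferInstance⟩ T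
    ((LinearMap.rangeRestrict T.toLinearMap).mkContinuous ‖T‖ fun x => T.le_opNorm x)
    (LinearMap.mkContinuous_norm_le _ (norm_nonneg _) _) rfl w

theorem finHull_delta_le_of_mem (X₀ : MFin X) (E₀ : FinDim 𝕜 E) {x y : X} {e : E}
    (hx : x ∈ X₀.set) (hy : y ∈ X₀.set) (he : e ∈ E₀.sub) :
    α.finHull (delta 𝕜 x y e) ≤ dist x y * ‖e‖ :=
  (α.finHull_le X₀ E₀ (tmap_delta X₀.incl E₀.sub.subtypeL ⟨x, hx⟩ ⟨y, hy⟩ ⟨e, he⟩)).trans_eq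
    (α.cross X₀.Pt E₀.sub ⟨x, hx⟩ ⟨y, hy⟩ ⟨e, he⟩)

theorem finHull_delta_le (x y : X) (e : E) : α.finHull (delta 𝕜 x y e) ≤ dist x y * ‖e‖ :=
  α.finHull_delta_le_of_mem ⟨{0, x, y}, Set.toFinite _, Or.inl rfl⟩
    ⟨Submodule.span 𝕜 {e}, inferInstance⟩ (Or.inr (Or.inl rfl)) (Or.inr (Or.inr rfl))
    (Submodule.mem_span_singleton_self e)

/-- Bounds on the finite hull of `X ⊠ E` extend to `Y ⊠ M` for finite-dimensional `M ⊂ E**`. -/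
theorem norm_apply_comp_le_of_finHull (Y : MFin X) {M : Type v} [NormedAddCommGroup M]
    [NormedSpace 𝕜 M] [CompleteSpace M] [FiniteDimensional 𝕜 M] (f : LipDual 𝕜 X E)
    (h : ∀ w : LipTensor 𝕜 X E, ‖w.1 f‖ ≤ α.finHull w)
    {J : StrongDual 𝕜 E →L[𝕜] StrongDual 𝕜 M} (hJ : ∀ φ, ‖J φ‖ ≤ ‖φ‖)
    (w : LipTensor 𝕜 Y.Pt M) : ‖w.1 (comp J Y.incl f)‖ ≤ 1 * α.nrm Y.Pt M w := by
  have hJ1 : ‖J‖ ≤ 1 := ContinuousLinearMap.opNorm_le_bound _ zero_le_one fun φ =>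
    (hJ φ).trans_eq (one_mul _).symm
  have hN : 0 ≤ α.nrm Y.Pt M w := α.nrm_nonneg w
  have h1 : ∀ T : M →L[𝕜] E, ‖(tmap Y.incl T w).1 f‖ ≤ α.nrm Y.Pt M w * ‖T‖ := fun T =>
    (h (tmap Y.incl T w)).trans (α.finHull_tmap_le Y T w)
  have h3 := LipTensor.norm_apply_comp_le w (comp (ContinuousLinearMap.id 𝕜 _) Y.incl f) hN h1 J
  exact h3.trans ((mul_le_of_le_one_right hN hJ1).trans_eq (one_mul _).symm)

/-- The finite hull of `α` is normed by the functionals it dominates. -/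
theorem exists_lip_apply_eq_finHull [CompleteSpace E] (w : LipTensor 𝕜 X E) :
    ∃ f : LipDual 𝕜 X E, (∀ z : LipTensor 𝕜 X E, ‖z.1 f‖ ≤ α.finHull z) ∧
      ‖w.1 f‖ = α.finHull w := by
  let p := α.finHullNorm X E
  obtain ⟨φ, hφ, hw⟩ := exists_dual_vector'' 𝕜 (p.toSpace w)
  have hb : ∀ z : LipTensor 𝕜 X E, ‖φ (p.toSpace z)‖ ≤ α.finHull z := fun z =>
    (φ.le_opNorm _).trans (mul_le_of_le_one_left (norm_nonneg _) hφ)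
  -- The norming functional is evaluation at a Lipschitz map because the hull is at most d(x, y)‖e‖
  -- on elementary tensors.
  obtain ⟨f, hf⟩ := LipTensor.exists_lip_of_bound (φ.toLinearMap.comp p.toSpace.toLinearMap)
    zero_le_one fun x y e => (hb _).trans ((α.finHull_delta_le x y e).trans_eq (one_mul _).symm)
  refine ⟨f, fun z => ?_, ?_⟩
  · rw [hf]
    exact hb z
  · rw [hf]
    refine (congrArg norm hw).trans ?_
    rw [RCLike.norm_ofReal, abs_norm]
    rfl

theorem isGLB_of_finHull_le [CompleteSpace E] {w : LipTensor 𝕜 X E}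
    (h : α.finHull w ≤ α.nrm X E w) :
    IsGLB {r : ℝ | ∃ (X₀ : MFin X) (E₀ : FinDim 𝕜 E) (w₀ : LipTensor 𝕜 X₀.Pt E₀.sub),
      tmap X₀.incl E₀.sub.subtypeL w₀ = w ∧ α.nrm X₀.Pt E₀.sub w₀ = r} (α.nrm X E w) := by
  constructor
  · rintro _ ⟨X₀, E₀, w₀, rfl, rfl⟩
    exact α.nrm_tmap_le X₀.lipConst_incl_le (norm_subtypeL_le _) w₀
  · intro r hr
    exact (α.le_finHull fun X₀ E₀ w₀ hw₀ => hr ⟨X₀, E₀, w₀, hw₀, rfl⟩).trans h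

end Hull

end GenericCrossNorm

/-! ### Finite generation of the cross-norm dual to a maximal ideal. -/

namespace GenericIdeal

variable {𝕜 : Type} [RCLike 𝕜] {A : GenericIdeal.{u, v} 𝕜}

theorem normLE_comp_of_forall {Y : Type u} [MetricSpace Y] [Zero Y] [Finite Y]
    {X : Type u} [MetricSpace X] [Zero X] {D G : Type v} [NormedAddCommGroup D] [NormedSpace 𝕜 D]
    [NormedAddCommGroup G] [NormedSpace 𝕜 G] [CompleteSpace G] [FiniteDimensional 𝕜 G]
    (k : PLip Y X) (f : Lip0 𝕜 X D)
    (h : ∀ (J : D →L[𝕜] StrongDual 𝕜 (StrongDual 𝕜 G)), (∀ d, ‖J d‖ ≤ ‖d‖) →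
      ∀ w : LipTensor 𝕜 Y (StrongDual 𝕜 G),
        ‖w.1 (comp J k f)‖ ≤ 1 * A.dualNorm Y (StrongDual 𝕜 G) w)
    {P : D →L[𝕜] G} (hP : ‖P‖ ≤ 1) : A.NormLE (comp P k f) 1 :=
  A.normLE_of_finite _ (h ((NormedSpace.inclusionInDoubleDual 𝕜 G).comp P) fun d =>
    (NormedSpace.double_dual_bound 𝕜 G _).trans
      ((P.le_opNorm d).trans (mul_le_of_le_one_left (norm_nonneg _) hP))) zero_le_one

theorem norm_apply_comp_le_of_finHull {X : Type u} [MetricSpace X] [Zero X]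
    {E M : Type v} [NormedAddCommGroup E] [NormedSpace 𝕜 E] [NormedAddCommGroup M]
    [NormedSpace 𝕜 M] [CompleteSpace M] [FiniteDimensional 𝕜 M] (Y : MFin X) (f : LipDual 𝕜 X E)
    (h : ∀ w : LipTensor 𝕜 X E, ‖w.1 f‖ ≤ A.dualCrossNorm.finHull w)
    (J : StrongDual 𝕜 E →L[𝕜] StrongDual 𝕜 M) (hJ : ∀ φ, ‖J φ‖ ≤ ‖φ‖) (w : LipTensor 𝕜 Y.Pt M) :
    ‖w.1 (comp J Y.incl f)‖ ≤ 1 * A.dualNorm Y.Pt M w :=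
  A.dualCrossNorm.norm_apply_comp_le_of_finHull Y f h hJ w

theorem finiteDimensional_strongDual (G : Type*) [NormedAddCommGroup G] [NormedSpace 𝕜 G]
    [FiniteDimensional 𝕜 G] : FiniteDimensional 𝕜 (StrongDual 𝕜 G) := inferInstance

/-- Finite duality tests P f I_Y on Y ⊠ G*. There κ_G P plays the role of the transpose of an
operator G* → E**, so local reflexivity with M = G* supplies the bound. -/
theorem normLE_comp_of_finHull {X : Type u} [MetricSpace X] [Zero X]
    {E G : Type v} [NormedAddCommGroup E] [NormedSpace 𝕜 E] [NormedAddCommGroup G]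
    [NormedSpace 𝕜 G] [CompleteSpace G] [FiniteDimensional 𝕜 G] (Y : MFin X) (f : LipDual 𝕜 X E)
    (h : ∀ w : LipTensor 𝕜 X E, ‖w.1 f‖ ≤ A.dualCrossNorm.finHull w)
    {P : StrongDual 𝕜 E →L[𝕜] G} (hP : ‖P‖ ≤ 1) : A.NormLE (comp P Y.incl f) 1 := by
  have := finiteDimensional_strongDual (𝕜 := 𝕜) G
  have key := norm_apply_comp_le_of_finHull (M := StrongDual 𝕜 G) Y f h
  exact normLE_comp_of_forall (D := StrongDual 𝕜 E) (G := G) Y.incl f key hP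

theorem IsMaximal.normLE_of_finHull (hA : A.IsMaximal) {X : Type u} [MetricSpace X] [Zero X]
    {E : Type v} [NormedAddCommGroup E] [NormedSpace 𝕜 E] [CompleteSpace E] (f : LipDual 𝕜 X E)
    (h : ∀ w : LipTensor 𝕜 X E, ‖w.1 f‖ ≤ A.dualCrossNorm.finHull w) : A.NormLE f 1 :=
  A.isMaximal_iff.1 hA X (StrongDual 𝕜 E) f 1 zero_le_one fun Y L => by
    have := L.finiteDimensional
    exact normLE_comp_of_finHull Y f h (CoFin.norm_proj_le L)

/-- A map norming w for the hull lies in the unit ball of A(X, E*), over which the dual norm is a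
supremum. Hence the hull does not exceed the dual norm. -/
theorem IsMaximal.isFinitelyGenerated_dualCrossNorm (hA : A.IsMaximal) :
    A.dualCrossNorm.IsFinitelyGenerated := fun X _ _ E _ _ _ w => by
  refine A.dualCrossNorm.isGLB_of_finHull_le ?_
  obtain ⟨f, hf, hw⟩ := A.dualCrossNorm.exists_lip_apply_eq_finHull w
  rw [← hw]
  exact ((hA.normLE_of_finHull f hf).norm_apply_le w).trans_eq (one_mul _)

end GenericIdeal
end LipschitzIdeals

theorem mainTheorem6 {𝕜 : Type} [RCLike 𝕜] (A : LipschitzIdeals.GenericIdeal.{u, v} 𝕜) :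
    (A.IsMaximal ↔
      ∃ α : LipschitzIdeals.GenericCrossNorm.{u, v} 𝕜, α.IsFinitelyGenerated ∧
        ∀ (X : Type u) [MetricSpace X] [Zero X] (E : Type v) [NormedAddCommGroup E]
          [NormedSpace 𝕜 E] [CompleteSpace E], A.RepresentedIn α X E) ∧
    ∀ α : LipschitzIdeals.GenericCrossNorm.{u, v} 𝕜, α.IsFinitelyGenerated →
      (∀ (X : Type u) [MetricSpace X] [Zero X] (E : Type v) [NormedAddCommGroup E]
        [NormedSpace 𝕜 E] [CompleteSpace E], A.RepresentedIn α X E) →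
      ∀ (X : Type u) [MetricSpace X] [Zero X] (E : Type v) [NormedAddCommGroup E]
        [NormedSpace 𝕜 E] [CompleteSpace E], A.DualRepresented α X E :=
  ⟨⟨fun hA => ⟨A.dualCrossNorm, hA.isFinitelyGenerated_dualCrossNorm,
      fun X _ _ E _ _ _ => hA.representedIn X E⟩,
    fun ⟨_, hα, hrep⟩ => LipschitzIdeals.GenericIdeal.isMaximal_of_representedIn hα hrep⟩,
    fun _ hα hrep X _ _ E _ _ _ =>
      LipschitzIdeals.GenericIdeal.dualRepresented_of_representedIn hα hrep X E⟩
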